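/- A ReLU network with $n$ input nodes and $m$ hidden nodes is a pair $(A,w)$ with $A\in[-1,1]^{m\times n}$ and $w\in[-1,1]^m$. It computes the function $\{0,1\}^n\to\{0,1\}$ that maps $x$ to $1$ if $w^T\mathrm{ReLU}(Ax)>0$ and to $0$ otherwise, where $\mathrm{ReLU}(y)=\max\{0,y\}$ entrywise. For a probability distribution $\mathcal D$ on $\{0,1\}^n$, the network is $(\varepsilon,\delta)$-close to computing $f:\{0,1\}^n\to\{0,1\}$ under $\mathcal D$ if one can change at most $\varepsilon nm$ entries of $A$ and at most $\varepsilon m$ entries of $w$ to obtain a ReLU network computing a function $g$ with $\Pr_{x\sim\mathcal D}[g(x)\ne f(x)]\le\delta$; otherwise it is $(\varepsilon,\delta)$-far. In the distribution-free model, a randomized adaptive algorithm may query entries of $A$, entries of $w$, and bits of samples from an unknown distribution $\mathcal D$ on $\{0,1\}^n$: query$(s,i)$ returns the $i$-th bit of the $s$-th sample $y_s$, where $y_1,y_2,\dots$ are drawn independently from $\mathcal D$. A distribution-free tester with parameters $(\varepsilon,\delta)$ for $f$ on networks with $n$ input and $m$ hidden nodes is such an algorithm that, for every network $(A,w)$ and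 every $\mathcal D$, accepts with probability at least $2/3$ if $(A,w)$ computes $f$, and rejects with probability at least $2/3$ if $(A,w)$ is $(\varepsilon,\delta)$-far from computing $f$ under $\mathcal D$. Its query complexity is the maximum total number of queries that it makes. **Theorem.** For every constant $k>1$ there are $\varepsilon_0>0$, $c>0$ and $n_0$, depending only on $k$, such that for all $n\ge n_0$, all $0<\varepsilon<\varepsilon_0$ and all $0<\delta<\frac12$, every distribution-free tester with parameters $(\varepsilon,\delta)$ for the constant $0$-function, even if it only has to work for networks with $n$ input nodes and $m=n$ hidden nodes, has query complexity at least $c\,n^{1-1/k}$. That is, for every constant $k>1$, testing the constant $0$-function in the distribution-free model requires $\Omega(n^{1-1/k})$ queries. -/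

import Mathlib

open scoped ENNReal

universe u

namespace ReLUTesting

/-- Edge weights: reals in `[-1, 1]`. -/
abbrev Weight : Type := Set.Icc (-1 : ℝ) 1

/-- Inputs of a network: vectors in `{0,1}^n`. -/
abbrev Cube (n : ℕ) : Type := Fin n → Bool

/-- The ReLU activation function. -/
def relu (y : ℝ) : ℝ := max 0 y

/-- A ReLU network with `n` input nodes, one hidden layer of `m` nodes and one output node:
`A j i` is the weight of the edge between input node `i` and hidden node `j`, and `w j` is the
weight of the edge between hidden node `j` and the output node. -/
structure Network (n m : ℕ) where
  A : Matrix (Fin m) (Fin n) Weight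
  w : Fin m → Weight

/-- The value `wᵀ · relu (A x)` at the output node. -/
noncomputable def Network.value {n m : ℕ} (G : Network n m) (x : Cube n) : ℝ :=
  ∑ j, (G.w j : ℝ) * relu (∑ i, (G.A j i : ℝ) * (if x i then 1 else 0))

/-- The Boolean function `sign (relu (wᵀ · relu (A x)))` computed by the network: it is `1`
if the value at the output node is positive, and `0` otherwise. -/
noncomputable def Network.compute {n m : ℕ} (G : Network n m) (x : Cube n) : Bool :=
  decide (0 < G.value x)

/-- `G` is `(ε, δ)`-close to computing `f` under the distribution `D`: one can change `A` in at
most `ε n m` places and `w` in at most `ε m` places to obtain a network that computes a function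
`g` with `Pr_{x ∼ D} [g x ≠ f x] ≤ δ`. -/
def Network.CloseTo {n m : ℕ} (ε δ : ℝ) (D : PMF (Cube n)) (f : Cube n → Bool)
    (G : Network n m) : Prop :=
  ∃ G' : Network n m,
    (Set.ncard {p : Fin m × Fin n | G'.A p.1 p.2 ≠ G.A p.1 p.2} : ℝ) ≤ ε * n * m ∧
    (Set.ncard {j : Fin m | G'.w j ≠ G.w j} : ℝ) ≤ ε * m ∧
    D.toMeasure {x | G'.compute x ≠ f x} ≤ ENNReal.ofReal δ

/-- `G` is `(ε, δ)`-far from computing `f` under the distribution `D`. -/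
def Network.FarFrom {n m : ℕ} (ε δ : ℝ) (D : PMF (Cube n)) (f : Cube n → Bool)
    (G : Network n m) : Prop :=
  ¬ G.CloseTo ε δ D f

/-- The constant `0`-function. -/
def zeroFunction (n : ℕ) : Cube n → Bool := fun _ => false

/-- A deterministic adaptive query strategy (a decision tree). It either stops and accepts
(`true`) or rejects (`false`), or queries a first layer weight, a second layer weight, or the
`i`-th bit of the `s`-th sample of the input distribution, and continues according to the
answer. -/
inductive Strategy (n m : ℕ) : Type
  | output (b : Bool) : Strategy n m
  | askFirst (j : Fin m) (i : Fin n) (next : Weight → Strategy n m) : Strategy n m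
  | askSecond (j : Fin m) (next : Weight → Strategy n m) : Strategy n m
  | askBit (s : ℕ) (i : Fin n) (next : Bool → Strategy n m) : Strategy n m

/-- The strategy makes at most `q` queries (to `A`, to `w` and to bits of samples, in total),
whatever the answers are. -/
def Strategy.QueriesAtMost {n m : ℕ} : Strategy n m → ℕ → Prop
  | .output _, _ => True
  | .askFirst _ _ _, 0 => False
  | .askFirst _ _ next, q + 1 => ∀ r, (next r).QueriesAtMost q
  | .askSecond _ _, 0 => False
  | .askSecond _ next, q + 1 => ∀ r, (next r).QueriesAtMost q
  | .askBit _ _ _, 0 => False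
  | .askBit _ _ next, q + 1 => ∀ r, (next r).QueriesAtMost q

/-- The probability that the strategy outputs `b` on the network `G` and the input distribution
`D`, when the samples drawn so far are those recorded in the second argument. At the first query
to sample number `s`, the sample is drawn from `D`, independently of everything before, and
recorded; later queries to sample number `s` read the recorded one. -/
noncomputable def Strategy.outputProb {n m : ℕ} (G : Network n m) (D : PMF (Cube n)) (b : Bool) :
    Strategy n m → (ℕ → Option (Cube n)) → ℝ≥0∞
  | .output b', _ => if b' = b then 1 else 0
  | .askFirst j i next, mem => (next (G.A j i)).outputProb G D b mem
  | .askSecond j next, mem => (next (G.w j)).outputProb G D b mem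
  | .askBit s i next, mem =>
    match mem s with
    | some y => (next (y i)).outputProb G D b mem
    | none => ∑ y, D y * (next (y i)).outputProb G D b (Function.update mem s (some y))

/-- A randomized query algorithm: a random seed `ω`, drawn from a probability space, selects a
deterministic adaptive query strategy. -/
structure RandomizedAlgorithm (n m : ℕ) : Type (u + 1) where
  /-- The space of random seeds. -/
  Ω : Type u
  [measurableSpace : MeasurableSpace Ω]
  /-- The law of the seed. -/
  P : MeasureTheory.Measure Ω
  [isProbabilityMeasure : MeasureTheory.IsProbabilityMeasure P]
  strategy : Ω → Strategy n m
  /-- Output probabilities are measurable in the seed, so that they can be averaged. -/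
  measurable_outputProb : ∀ (G : Network n m) (D : PMF (Cube n)) (b : Bool),
    Measurable fun ω => (strategy ω).outputProb G D b fun _ => none

attribute [instance] RandomizedAlgorithm.measurableSpace RandomizedAlgorithm.isProbabilityMeasure

/-- The probability, over the seed and over the samples from `D`, that the algorithm outputs `b`
on the network `G` and the input distribution `D`. Initially no sample has been drawn. -/
noncomputable def RandomizedAlgorithm.outputProb {n m : ℕ} (T : RandomizedAlgorithm.{u} n m)
    (G : Network n m) (D : PMF (Cube n)) (b : Bool) : ℝ≥0∞ :=
  ∫⁻ ω, (T.strategy ω).outputProb G D b (fun _ => none) ∂T.P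

/-- The algorithm makes at most `q` queries, whatever its seed and the answers are. -/
def RandomizedAlgorithm.QueriesAtMost {n m : ℕ} (T : RandomizedAlgorithm.{u} n m) (q : ℕ) : Prop :=
  ∀ ω, (T.strategy ω).QueriesAtMost q

/-- `T` is a property tester for computing `f` in the distribution-free model, for networks with
`n` input nodes and `m` hidden nodes and with parameters `ε, δ`: for every (unknown) input
distribution `D` it accepts with probability at least `2/3` every network that computes `f`, and
it rejects with probability at least `2/3` every network that is `(ε, δ)`-far from computing `f`
under `D`. -/
def RandomizedAlgorithm.IsDistributionFreeTester {n m : ℕ} (T : RandomizedAlgorithm.{u} n m)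
    (ε δ : ℝ) (f : Cube n → Bool) : Prop :=
  ∀ (G : Network n m) (D : PMF (Cube n)),
    (G.compute = f → 2 / 3 ≤ T.outputProb G D true) ∧
    (G.FarFrom ε δ D f → 2 / 3 ≤ T.outputProb G D false)

end ReLUTesting

/-!
The hard instances hide blocks of `K ≥ k` columns, and only a set of queries that hits all `K`
columns of some block is of any use; this is a `K`-fold birthday problem, which takes about
`n ^ (1 - 1 / K)` queries.

A matrix `U` of bits gives a network (`bitNetwork`): a third of the rows has output weight `3 / 4`
(the set `P`) and a third has output weight `-1` (the set `R`). In these rows a bit `0` is the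
weight `1 / (4 * K)` and a bit `1` the weight `-1`, so that a row contributes to an input with at
most `4 * K` active coordinates only if all its active bits are `0`. The remaining rows contribute
a small negative multiple of the number of active coordinates.

If the bits are independent and uniform, then about the same number of rows of `P` and of `R`
vanishes on each set of at most `2 * K` columns (`exists_card_balanced_ge`, by a Chernoff bound).
Hence `R` outweighs `P` on small inputs. On larger inputs the contribution of `P` is bounded by
subadditivity of the activation, and is outweighed by the remaining rows. So the network computes
the constant `0`-function (`compute_bitNetwork`).

The columns are divided into about `n / K` blocks of size `K`, by means of secret random shifts.
If in each row of `P` the parity of each block is made even by changing one bit (`repair`), then a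
row of `P` vanishes on a block with probability `2 ^ (-(K - 1))` instead of `2 ^ (-K)`, so that the
value at the indicator of the block is positive, of order `n`. Under the uniform distribution on
the block indicators such a network is far from the constant `0`-function, since a few changes
cannot affect half of the blocks much (`farFrom_of_blocks`, `farFrom_repair`).

A strategy with `q` queries cannot tell the two networks apart. A sample has only `K` nonzero bits
in secret positions, and so the samples can be taken to be `0` (`Strategy.outputProb_le`). As long
as no whole block of columns is read, the repaired bits look uniform, by a bijection that moves the
change of parity to a column that is not read (`card_not_containsBlock_le`). For uniform bits the
columns that are read do not depend on the shifts, and so the probability that they contain a block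
is at most `N * (q / N) ^ K`, where `N` is the number of blocks (`card_containsBlock_le`). A tester
would have to succeed on both kinds of networks, which is impossible if this is small
(`query_bound_of_good`, `query_lower_bound`).
-/

namespace ReLUTesting

/-! ### Running a strategy with all sample bits answered by zero -/

namespace Strategy

variable {n m : ℕ}

/-- The output of the strategy on the network `G` when every queried sample bit is `0`. -/
def zeroOutput (G : Network n m) : Strategy n m → Bool
  | .output b => b
  | .askFirst j i next => (next (G.A j i)).zeroOutput G
  | .askSecond j next => (next (G.w j)).zeroOutput G
  | .askBit _ _ next => (next false).zeroOutput G

/-- The sample bits queried by the strategy on `G` when every queried sample bit is `0`. -/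
def zeroBits (G : Network n m) : Strategy n m → List (ℕ × Fin n)
  | .output _ => []
  | .askFirst j i next => (next (G.A j i)).zeroBits G
  | .askSecond j next => (next (G.w j)).zeroBits G
  | .askBit s i next => (s, i) :: (next false).zeroBits G

/-- The columns of the first layer that are queried by the strategy on `G` when every queried
sample bit is `0`. -/
def zeroColumns (G : Network n m) : Strategy n m → Finset (Fin n)
  | .output _ => ∅
  | .askFirst j i next => insert i ((next (G.A j i)).zeroColumns G)
  | .askSecond j next => (next (G.w j)).zeroColumns G
  | .askBit _ _ next => (next false).zeroColumns G

theorem length_zeroBits_le (G : Network n m) (σ : Strategy n m) :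
    ∀ q, σ.QueriesAtMost q → (σ.zeroBits G).length ≤ q := by
  induction σ with
  | output b => intro q _; simp [zeroBits]
  | askFirst j i next ih =>
    rintro (_ | q) h
    · exact h.elim
    · exact (ih _ q (h _)).trans q.le_succ
  | askSecond j next ih =>
    rintro (_ | q) h
    · exact h.elim
    · exact (ih _ q (h _)).trans q.le_succ
  | askBit s i next ih =>
    rintro (_ | q) h
    · exact h.elim
    · exact Nat.succ_le_succ (ih _ q (h _))

theorem card_zeroColumns_le (G : Network n m) (σ : Strategy n m) :
    ∀ q, σ.QueriesAtMost q → (σ.zeroColumns G).card ≤ q := by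
  induction σ with
  | output b => intro q _; simp [zeroColumns]
  | askFirst j i next ih =>
    rintro (_ | q) h
    · exact h.elim
    · exact (Finset.card_insert_le _ _).trans (Nat.succ_le_succ (ih _ q (h _)))
  | askSecond j next ih =>
    rintro (_ | q) h
    · exact h.elim
    · exact (ih _ q (h _)).trans q.le_succ
  | askBit s i next ih =>
    rintro (_ | q) h
    · exact h.elim
    · exact (ih _ q (h _)).trans q.le_succ

/-- Two networks that agree on the columns that the strategy reads cannot be told apart. -/
theorem zero_run_congr {G G' : Network n m} (hw : G.w = G'.w) (σ : Strategy n m)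
    (hA : ∀ i ∈ σ.zeroColumns G, ∀ j, G.A j i = G'.A j i) :
    σ.zeroOutput G' = σ.zeroOutput G ∧ σ.zeroColumns G' = σ.zeroColumns G := by
  induction σ with
  | output b => simp [zeroOutput, zeroColumns]
  | askFirst j i next ih =>
    simp only [zeroColumns, Finset.mem_insert] at hA
    have h := ih (G.A j i) fun i' hi' => hA i' (Or.inr hi')
    simp only [zeroOutput, zeroColumns, ← hA i (Or.inl rfl) j, h.1, h.2, and_self]
  | askSecond j next ih =>
    simpa only [zeroOutput, zeroColumns, ← hw] using ih _ hA
  | askBit s i next ih => exact ih _ hA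

theorem _root_.PMF.sum_coe_of_fintype {α : Type*} [Fintype α] (D : PMF α) : ∑ y, D y = 1 := by
  exact (tsum_fintype (L := .unconditional α) D).symm.trans D.tsum_coe

theorem outputProb_le_one (G : Network n m) (D : PMF (Cube n)) (b : Bool) (σ : Strategy n m) :
    ∀ mem, σ.outputProb G D b mem ≤ 1 := by
  induction σ with
  | output b' => intro mem; simp only [outputProb]; split_ifs <;> simp
  | askFirst j i next ih => exact ih _
  | askSecond j next ih => exact ih _
  | askBit s i next ih =>
    intro mem
    simp only [outputProb]
    split
    · exact ih _ _
    · calc _ ≤ ∑ y, D y * 1 := Finset.sum_le_sum fun y _ => by gcongr; exact ih _ _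
        _ = 1 := by simp [D.sum_coe_of_fintype]

/-- The probability that the queried sample bit `p` is `1`, given the samples drawn so far. -/
noncomputable def bitProb (D : PMF (Cube n)) (mem : ℕ → Option (Cube n)) (p : ℕ × Fin n) : ℝ≥0∞ :=
  match mem p.1 with
  | some y => if y p.2 then 1 else 0
  | none => ∑ y, D y * if y p.2 then 1 else 0

/-- Drawing a new sample does not change the expected value of `bitProb`. -/
theorem sum_mul_bitProb_update (D : PMF (Cube n)) (mem : ℕ → Option (Cube n)) {s : ℕ}
    (hs : mem s = none) (p : ℕ × Fin n) :
    ∑ y, D y * bitProb D (Function.update mem s (some y)) p = bitProb D mem p := by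
  rcases eq_or_ne p.1 s with h | h
  · simp [bitProb, h, hs]
  · simp only [bitProb, Function.update_of_ne h, ← Finset.sum_mul]
    simp [D.sum_coe_of_fintype]

theorem sum_mul_sum_bitProb_update (D : PMF (Cube n)) (mem : ℕ → Option (Cube n)) {s : ℕ}
    (hs : mem s = none) (l : List (ℕ × Fin n)) :
    ∑ y, D y * (l.map (bitProb D (Function.update mem s (some y)))).sum =
      (l.map (bitProb D mem)).sum := by
  induction l with
  | nil => simp
  | cons p l ih =>
    simp only [List.map_cons, List.sum_cons, mul_add, Finset.sum_add_distrib, ih,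
      sum_mul_bitProb_update D mem hs]

/-- A strategy behaves as if all sample bits were `0`, up to the probability that one of the bits
that it queries is `1`, to which the union bound applies. -/
theorem outputProb_le (G : Network n m) (D : PMF (Cube n)) (b : Bool) (σ : Strategy n m) :
    ∀ mem, σ.outputProb G D b mem ≤
      (if σ.zeroOutput G = b then 1 else 0) + ((σ.zeroBits G).map (bitProb D mem)).sum := by
  induction σ with
  | output b' => exact fun mem => le_self_add
  | askFirst j i next ih => exact ih _
  | askSecond j next ih => exact ih _
  | askBit s i next ih =>
    intro mem
    simp only [outputProb, zeroOutput, zeroBits, List.map_cons, List.sum_cons]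
    split
    next y hy =>
      by_cases hyi : y i = true
      · refine (outputProb_le_one _ _ _ _ _).trans ?_
        simp only [bitProb, hy, hyi, if_true]
        rw [add_left_comm]
        exact le_self_add
      · rw [Bool.not_eq_true] at hyi
        have h0 : bitProb D mem (s, i) = 0 := by simp [bitProb, hy, hyi]
        rw [h0, zero_add, hyi]
        exact ih false mem
    next hs =>
      set c : ℝ≥0∞ := if (next false).zeroOutput G = b then 1 else 0
      set l := (next false).zeroBits G
      calc ∑ y, D y * (next (y i)).outputProb G D b (Function.update mem s (some y))
          ≤ ∑ y, (D y * c + (D y * (if y i then 1 else 0) +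
              D y * (l.map (bitProb D (Function.update mem s (some y)))).sum)) := by
            refine Finset.sum_le_sum fun y _ => ?_
            rw [← mul_add, ← mul_add]
            gcongr
            by_cases hyi : y i = true
            · refine (outputProb_le_one _ _ _ _ _).trans ?_
              simp only [hyi, if_true]
              rw [add_left_comm]
              exact le_self_add
            · rw [Bool.not_eq_true] at hyi
              rw [hyi, if_neg Bool.false_ne_true, zero_add]
              exact ih false (Function.update mem s (some y))
        _ = c + (bitProb D mem (s, i) + (l.map (bitProb D mem)).sum) := by
            rw [Finset.sum_add_distrib, Finset.sum_add_distrib,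
              sum_mul_sum_bitProb_update D mem hs, ← Finset.sum_mul]
            simp [bitProb, hs, D.sum_coe_of_fintype]

/-- The bound of `outputProb_le` when no sample has been drawn yet and each bit of a sample is `1`
with probability at most `p`. -/
theorem outputProb_le_of_bits (G : Network n m) (D : PMF (Cube n)) (b : Bool) (σ : Strategy n m)
    {q : ℕ} (hq : σ.QueriesAtMost q) {p : ℝ≥0∞}
    (hp : ∀ i, ∑ y, D y * (if y i then 1 else 0) ≤ p) :
    σ.outputProb G D b (fun _ => none) ≤ (if σ.zeroOutput G = b then 1 else 0) + q * p := by
  refine (outputProb_le G D b σ _).trans ?_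
  gcongr
  calc ((σ.zeroBits G).map (bitProb D fun _ => none)).sum
      ≤ ((σ.zeroBits G).map (bitProb D fun _ => none)).length • p := by
        refine List.sum_le_card_nsmul _ _ fun x hx => ?_
        obtain ⟨s, -, rfl⟩ := List.mem_map.1 hx
        exact hp s.2
    _ ≤ q * p := by
        rw [List.length_map, nsmul_eq_mul]
        gcongr
        exact length_zeroBits_le G σ q hq

end Strategy

/-! ### Concentration for uniformly random bits -/

/-- Matrices of bits. In the networks below, the bit `0` stands for a small positive weight and the
bit `1` for the weight `-1`. -/
abbrev BitMatrix (n : ℕ) : Type := Fin n → Fin n → ZMod 2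

variable {n : ℕ}

/-- The rows of `T` that vanish on all columns of `S`. -/
def zeroRows (U : BitMatrix n) (T S : Finset (Fin n)) : Finset (Fin n) :=
  T.filter fun j => ∀ i ∈ S, U j i = 0

theorem card_vanishing (S : Finset (Fin n)) :
    ((Finset.univ.filter fun u : Fin n → ZMod 2 => ∀ i ∈ S, u i = 0).card : ℝ) =
      2 ^ n * (1 / 2) ^ S.card := by
  have h : (Finset.univ.filter fun u : Fin n → ZMod 2 => ∀ i ∈ S, u i = 0) =
      Fintype.piFinset fun i => if i ∈ S then {0} else Finset.univ := by
    ext u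
    simp only [Finset.mem_filter, Finset.mem_univ, true_and, Fintype.mem_piFinset]
    refine forall_congr' fun i => ?_
    split_ifs with hi <;> simp [hi]
  rw [h, Fintype.card_piFinset]
  have h2 : ∀ i : Fin n, ((if i ∈ S then ({0} : Finset (ZMod 2)) else Finset.univ).card : ℝ) =
      2 * (if i ∈ S then 1 / 2 else 1) := by
    intro i
    split_ifs <;> simp [ZMod.card]
  push_cast
  simp only [h2, Finset.prod_mul_distrib]
  simp

/-- The exponential moment of a sum of independent centred variables with values in `[-1, 1]`. -/
theorem sum_exp_le {ι Ω : Type*} [Fintype ι] [DecidableEq ι] [Fintype Ω] (T : Finset ι)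
    (X : Ω → ℝ) (hX : ∀ u, |X u| ≤ 1) (h0 : ∑ u, X u = 0) {l : ℝ} (hl : |l| ≤ 1) :
    ∑ U : ι → Ω, Real.exp (l * ∑ j ∈ T, X (U j)) ≤
      (Fintype.card (ι → Ω) : ℝ) * Real.exp (l ^ 2 * T.card) := by
  classical
  have hone : ∑ u, Real.exp (l * X u) ≤ Fintype.card Ω * Real.exp (l ^ 2) := by
    have hle : ∀ u, Real.exp (l * X u) ≤ 1 + l * X u + l ^ 2 := by
      intro u
      have hlx : |l * X u| ≤ |l| := by
        rw [abs_mul]; exact mul_le_of_le_one_right (abs_nonneg _) (hX u)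
      have h1 := (abs_le.1 (Real.abs_exp_sub_one_sub_id_le (hlx.trans hl))).2
      have h2 : (l * X u) ^ 2 ≤ l ^ 2 := sq_le_sq.2 hlx
      linarith
    calc ∑ u, Real.exp (l * X u) ≤ ∑ u, (1 + l * X u + l ^ 2) :=
          Finset.sum_le_sum fun u _ => hle u
      _ = Fintype.card Ω * (l ^ 2 + 1) := by
          simp only [Finset.sum_add_distrib, ← Finset.mul_sum, h0]
          simp; ring
      _ ≤ _ := by gcongr; exact Real.add_one_le_exp _
  calc ∑ U : ι → Ω, Real.exp (l * ∑ j ∈ T, X (U j))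
      = ∑ U : ι → Ω, ∏ j, (if j ∈ T then Real.exp (l * X (U j)) else 1) := by
        refine Finset.sum_congr rfl fun U _ => ?_
        rw [Finset.mul_sum, Real.exp_sum, Finset.prod_ite_mem]
        simp
    _ = ∏ j : ι, ∑ u, (if j ∈ T then Real.exp (l * X u) else 1) := by
        rw [Finset.prod_univ_sum]; simp
    _ ≤ ∏ j : ι, (Fintype.card Ω : ℝ) * (if j ∈ T then Real.exp (l ^ 2) else 1) := by
        refine Finset.prod_le_prod (fun j _ => Finset.sum_nonneg fun u _ => ?_) fun j _ => ?_
        · split_ifs <;> positivity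
        · split_ifs
          · exact hone
          · simp
    _ = _ := by
        rw [Finset.prod_mul_distrib, Finset.prod_ite_mem]
        simp [mul_comm (l ^ 2), Real.exp_nat_mul]

/-- A Chernoff bound, in the form of a count. -/
theorem card_le_of_exp {ι Ω : Type*} [Fintype ι] [DecidableEq ι] [Fintype Ω] (T : Finset ι)
    (X : Ω → ℝ) (hX : ∀ u, |X u| ≤ 1) (h0 : ∑ u, X u = 0) {η : ℝ} (hη : 0 ≤ η) (hη1 : η ≤ 1)
    (B : Finset (ι → Ω)) (hB : ∀ U ∈ B, η * T.card ≤ ∑ j ∈ T, X (U j)) :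
    (B.card : ℝ) ≤ (Fintype.card (ι → Ω) : ℝ) * Real.exp (-(η ^ 2 / 4 * T.card)) := by
  -- The parameter `η / 2` minimizes `l ^ 2 - l * η`.
  have h1 := sum_exp_le T X hX h0 (l := η / 2) (by rw [abs_of_nonneg] <;> linarith)
  have h2 : (B.card : ℝ) * Real.exp (η / 2 * (η * T.card)) ≤
      ∑ U : ι → Ω, Real.exp (η / 2 * ∑ j ∈ T, X (U j)) := by
    calc (B.card : ℝ) * Real.exp (η / 2 * (η * T.card))
        = ∑ U ∈ B, Real.exp (η / 2 * (η * T.card)) := by simp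
      _ ≤ ∑ U ∈ B, Real.exp (η / 2 * ∑ j ∈ T, X (U j)) := by
          refine Finset.sum_le_sum fun U hU => ?_
          have := hB U hU
          gcongr
      _ ≤ _ := Finset.sum_le_sum_of_subset_of_nonneg (Finset.subset_univ _)
          fun _ _ _ => (Real.exp_pos _).le
  have h3 : (B.card : ℝ) ≤ (Fintype.card (ι → Ω) : ℝ) * Real.exp ((η / 2) ^ 2 * T.card) /
      Real.exp (η / 2 * (η * T.card)) := by
    rw [le_div_iff₀ (Real.exp_pos _)]; exact h2.trans h1
  rw [mul_div_assoc, ← Real.exp_sub] at h3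
  convert h3 using 3
  ring

/-- The bit matrix `U` is balanced on the rows `T`: for every set `S` of at most `d` columns, about
a fraction `2 ^ (-|S|)` of these rows vanishes on `S`, up to an error `η`. -/
def Balanced (U : BitMatrix n) (T : Finset (Fin n)) (d : ℕ) (η : ℝ) : Prop :=
  ∀ S : Finset (Fin n), S.card ≤ d →
    |((zeroRows U T S).card : ℝ) - (1 / 2) ^ S.card * T.card| ≤ η * T.card

open Classical in
theorem card_deviating_le (T S : Finset (Fin n)) {η : ℝ} (hη : 0 ≤ η) (hη1 : η ≤ 1) :
    ((Finset.univ.filter fun U : BitMatrix n =>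
      ¬ |((zeroRows U T S).card : ℝ) - (1 / 2) ^ S.card * T.card| ≤ η * T.card).card : ℝ) ≤
      Fintype.card (BitMatrix n) * (2 * Real.exp (-(η ^ 2 / 4 * T.card))) := by
  let X : (Fin n → ZMod 2) → ℝ := fun u => (if ∀ i ∈ S, u i = 0 then 1 else 0) - (1 / 2) ^ S.card
  have hp0 : (0 : ℝ) ≤ (1 / 2) ^ S.card := by positivity
  have hp1 : ((1 : ℝ) / 2) ^ S.card ≤ 1 := pow_le_one₀ (by norm_num) (by norm_num)
  have hX : ∀ u, |X u| ≤ 1 := by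
    intro u
    simp only [X]
    rw [abs_le]
    split_ifs <;> constructor <;> linarith
  have h0 : ∑ u, X u = 0 := by
    simp only [X, Finset.sum_sub_distrib, Finset.sum_boole, card_vanishing]
    simp [ZMod.card]
  have hsum : ∀ U : BitMatrix n, ∑ j ∈ T, X (U j) =
      ((zeroRows U T S).card : ℝ) - (1 / 2) ^ S.card * T.card := by
    intro U
    simp only [X, Finset.sum_sub_distrib, Finset.sum_boole, zeroRows]
    simp [mul_comm]
  have hX' : ∀ u, |-X u| ≤ 1 := fun u => by rw [abs_neg]; exact hX u
  have h1 := card_le_of_exp T X hX h0 hη hη1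
    (Finset.univ.filter fun U : BitMatrix n => η * T.card ≤ ∑ j ∈ T, X (U j)) (by simp)
  have h2 := card_le_of_exp T (fun u => -X u) hX' (by simp [h0]) hη hη1
    (Finset.univ.filter fun U : BitMatrix n => η * T.card ≤ ∑ j ∈ T, -X (U j)) (by simp)
  rw [two_mul, mul_add]
  refine le_trans ?_ (add_le_add h1 h2)
  rw [← Nat.cast_add]
  refine Nat.cast_le.2 ((Finset.card_le_card fun U hU => ?_).trans (Finset.card_union_le _ _))
  simp only [Finset.mem_filter, Finset.mem_univ, true_and, Finset.mem_union, not_le,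
    Finset.sum_neg_distrib, hsum, lt_abs] at hU ⊢
  exact hU.imp le_of_lt le_of_lt

theorem card_small_sets_le (d : ℕ) :
    (Finset.univ.filter fun S : Finset (Fin n) => S.card ≤ d).card ≤ (d + 1) * (n + 1) ^ d := by
  have h : (Finset.univ.filter fun S : Finset (Fin n) => S.card ≤ d) ⊆
      (Finset.range (d + 1)).biUnion fun s => Finset.univ.powersetCard s := by
    intro S hS
    simpa [Nat.lt_succ_iff] using hS
  refine (Finset.card_le_card h).trans ((Finset.card_biUnion_le_card_mul _ _ ((n + 1) ^ d) ?_).trans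
    (by simp))
  intro s hs
  rw [Finset.card_powersetCard, Finset.card_univ, Fintype.card_fin]
  calc n.choose s ≤ n ^ s := Nat.choose_le_pow n s
    _ ≤ (n + 1) ^ s := by gcongr; omega
    _ ≤ (n + 1) ^ d := by gcongr; · omega
                          · simpa [Nat.lt_succ_iff] using hs

open Classical in
/-- The union bound over all small sets of columns. -/
theorem card_not_balanced_le (T : Finset (Fin n)) (d : ℕ) {η : ℝ} (hη : 0 ≤ η) (hη1 : η ≤ 1) :
    ((Finset.univ.filter fun U : BitMatrix n => ¬ Balanced U T d η).card : ℝ) ≤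
      Fintype.card (BitMatrix n) *
        ((d + 1) * (n + 1) ^ d * (2 * Real.exp (-(η ^ 2 / 4 * T.card)))) := by
  set F := Finset.univ.filter fun S : Finset (Fin n) => S.card ≤ d
  set dev := fun S : Finset (Fin n) => Finset.univ.filter fun U : BitMatrix n =>
      ¬ |((zeroRows U T S).card : ℝ) - (1 / 2) ^ S.card * T.card| ≤ η * T.card
  have h : (Finset.univ.filter fun U : BitMatrix n => ¬ Balanced U T d η) ⊆ F.biUnion dev := by
    intro U hU
    simp only [Balanced, Finset.mem_filter, Finset.mem_univ, true_and, not_forall] at hU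
    obtain ⟨S, hS, hU⟩ := hU
    simp only [F, dev, Finset.mem_biUnion, Finset.mem_filter, Finset.mem_univ, true_and]
    exact ⟨S, hS, hU⟩
  calc ((Finset.univ.filter fun U : BitMatrix n => ¬ Balanced U T d η).card : ℝ)
      ≤ ∑ S ∈ F, ((dev S).card : ℝ) := by
        rw [← Nat.cast_sum]
        exact Nat.cast_le.2 ((Finset.card_le_card h).trans Finset.card_biUnion_le)
    _ ≤ ∑ S ∈ F, Fintype.card (BitMatrix n) * (2 * Real.exp (-(η ^ 2 / 4 * T.card))) :=
        Finset.sum_le_sum fun S _ => card_deviating_le T S hη hη1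
    _ = F.card * (Fintype.card (BitMatrix n) * (2 * Real.exp (-(η ^ 2 / 4 * T.card)))) := by simp
    _ ≤ ((d + 1) * (n + 1) ^ d : ℕ) *
          (Fintype.card (BitMatrix n) * (2 * Real.exp (-(η ^ 2 / 4 * T.card)))) := by
        gcongr
        exact card_small_sets_le d
    _ = _ := by push_cast; ring

/-! ### Networks given by bit matrices -/

/-- The weight that encodes a bit: `0` is a small positive weight, `1` is the weight `-1`. A row
with at most `4 * K` active inputs is switched off by a single bit `1` among them. -/
noncomputable def bitWeight (K : ℕ) (b : ZMod 2) : Weight :=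
  if b = 0 then ⟨1 / (4 * K), by
    have h : (1 : ℝ) / (4 * K) ≤ 1 := by
      rcases Nat.eq_zero_or_pos K with rfl | hK
      · norm_num
      · have : (1 : ℝ) ≤ K := by exact_mod_cast hK
        rw [div_le_one (by positivity)]
        linarith
    have h0 : (0 : ℝ) ≤ 1 / (4 * K) := by positivity
    exact ⟨by linarith, h⟩⟩
  else ⟨-1, by norm_num⟩

/-- The output weight of the rows that carry no bits, up to the sign. -/
noncomputable def linearWeight (K : ℕ) : Weight :=
  ⟨(1 / 2) ^ (2 * K) / (4 * K), by
    have h1 : ((1 : ℝ) / 2) ^ (2 * K) ≤ 1 := pow_le_one₀ (by norm_num) (by norm_num)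
    have h0 : (0 : ℝ) ≤ (1 / 2) ^ (2 * K) / (4 * K) := by positivity
    refine ⟨by linarith, ?_⟩
    rcases Nat.eq_zero_or_pos K with rfl | hK
    · norm_num
    · have : (1 : ℝ) ≤ K := by exact_mod_cast hK
      rw [div_le_one (by positivity)]
      linarith⟩

/-- The network of the bit matrix `U`: the rows in `P` have positive output weights, those in `R`
have negative ones, and all other rows have weights `1`, so that together they contribute a
negative multiple of the number of active inputs. -/
noncomputable def bitNetwork (K : ℕ) (P R : Finset (Fin n)) (U : BitMatrix n) :
    Network n n where
  A j i := if j ∈ P ∪ R then bitWeight K (U j i) else ⟨1, by norm_num⟩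
  w j := if j ∈ P then ⟨3 / 4, by norm_num⟩ else if j ∈ R then ⟨-1, by norm_num⟩ else
    ⟨-linearWeight K, by
      have := (linearWeight K).2
      rw [Set.mem_Icc] at this ⊢
      constructor <;> linarith [this.1, this.2]⟩

/-- The set of active inputs. -/
def support (x : Cube n) : Finset (Fin n) := Finset.univ.filter fun i => x i = true

/-- The input whose active coordinates are those in `S`. -/
def indicator (S : Finset (Fin n)) : Cube n := fun i => decide (i ∈ S)

@[simp] theorem support_indicator (S : Finset (Fin n)) : support (indicator S) = S := by
  ext i; simp [support, indicator]

theorem Network.value_eq {m : ℕ} (G : Network n m) (x : Cube n) :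
    G.value x = ∑ j, (G.w j : ℝ) * relu (∑ i ∈ support x, (G.A j i : ℝ)) := by
  simp [Network.value, support, Finset.sum_filter]

/-- The value at a row with bits `u` of the input with support `S`, after activation. -/
noncomputable def bitRelu (K : ℕ) (u : Fin n → ZMod 2) (S : Finset (Fin n)) : ℝ :=
  relu (∑ i ∈ S, (bitWeight K (u i) : ℝ))

theorem relu_add_le (a b : ℝ) : relu (a + b) ≤ relu a + relu b := by
  unfold relu
  rcases max_cases 0 a with h | h <;> rcases max_cases 0 b with h' | h' <;>
    rcases max_cases 0 (a + b) with h'' | h'' <;> linarith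

theorem bitWeight_le (K : ℕ) (b : ZMod 2) : (bitWeight K b : ℝ) ≤ 1 / (4 * K) := by
  unfold bitWeight
  split_ifs
  · exact le_rfl
  · have : (0 : ℝ) ≤ 1 / (4 * K) := by positivity
    show (-1 : ℝ) ≤ _
    linarith

theorem bitRelu_of_card_le {K : ℕ} (hK : 0 < K) (u : Fin n → ZMod 2) {S : Finset (Fin n)}
    (hS : S.card ≤ 4 * K) :
    bitRelu K u S = if ∀ i ∈ S, u i = 0 then (S.card : ℝ) / (4 * K) else 0 := by
  unfold bitRelu
  split_ifs with h
  · rw [Finset.sum_congr rfl fun i hi => by rw [h i hi]]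
    simp only [bitWeight, if_true, Finset.sum_const, nsmul_eq_mul]
    rw [relu, max_eq_right (by positivity)]
    ring
  · push Not at h
    obtain ⟨i, hi, hui⟩ := h
    refine max_eq_left ?_
    rw [← Finset.add_sum_erase _ _ hi]
    have h1 : (bitWeight K (u i) : ℝ) = -1 := by simp [bitWeight, hui]
    have h2 : ∑ k ∈ S.erase i, (bitWeight K (u k) : ℝ) ≤ (S.erase i).card • (1 / (4 * K) : ℝ) :=
      Finset.sum_le_card_nsmul _ _ _ fun k _ => bitWeight_le K _
    have h3 : ((S.erase i).card : ℝ) ≤ 4 * K := by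
      exact_mod_cast (Finset.card_erase_le).trans hS
    have h4 : (S.erase i).card • (1 / (4 * K) : ℝ) ≤ 1 := by
      have : (0 : ℝ) < 4 * K := by positivity
      rw [nsmul_eq_mul, mul_one_div, div_le_one this]
      exact h3
    linarith

theorem sum_bitRelu_of_card_le {K : ℕ} (hK : 0 < K) (U : BitMatrix n) (T : Finset (Fin n))
    {S : Finset (Fin n)} (hS : S.card ≤ 4 * K) :
    ∑ j ∈ T, bitRelu K (U j) S = (S.card : ℝ) / (4 * K) * (zeroRows U T S).card := by
  simp only [bitRelu_of_card_le hK _ hS, zeroRows, ← Finset.sum_filter]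
  simp [mul_comm]

theorem zeroRows_anti (U : BitMatrix n) (T : Finset (Fin n)) {S S' : Finset (Fin n)}
    (h : S ⊆ S') : zeroRows U T S' ⊆ zeroRows U T S := fun j hj => by
  simp only [zeroRows, Finset.mem_filter] at hj ⊢
  exact ⟨hj.1, fun i hi => hj.2 i (h hi)⟩

/-- A large input is cut into pieces of size between `2 * K` and `4 * K`; since the activation is
subadditive, the bound for the pieces gives one for the input. -/
theorem sum_bitRelu_le {K : ℕ} (hK : 0 < K) (U : BitMatrix n) (T : Finset (Fin n)) {g : ℝ}
    (hg : ∀ C : Finset (Fin n), C.card = 2 * K → ((zeroRows U T C).card : ℝ) ≤ g) :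
    ∀ S : Finset (Fin n), 2 * K ≤ S.card →
      ∑ j ∈ T, bitRelu K (U j) S ≤ (S.card : ℝ) / (4 * K) * g := by
  intro S
  induction S using Finset.strongInduction with
  | H S ih =>
  intro hS
  obtain ⟨C, hCS, hC⟩ := Finset.exists_subset_card_eq hS
  have hsmall : ∀ S' : Finset (Fin n), C ⊆ S' → S'.card ≤ 4 * K →
      ∑ j ∈ T, bitRelu K (U j) S' ≤ (S'.card : ℝ) / (4 * K) * g := by
    intro S' hCS' hS'
    rw [sum_bitRelu_of_card_le hK U T hS']
    refine mul_le_mul_of_nonneg_left ?_ (by positivity)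
    exact (Nat.cast_le.2 (Finset.card_le_card (zeroRows_anti U T hCS'))).trans (hg C hC)
  rcases le_or_gt S.card (4 * K) with h | h
  · exact hsmall S hCS h
  · have hcard : (S \ C).card = S.card - 2 * K := by rw [Finset.card_sdiff_of_subset hCS, hC]
    have hss : S \ C ⊂ S := by
      refine Finset.sdiff_ssubset hCS ?_
      rw [← Finset.card_pos, hC]
      omega
    have h1 := ih (S \ C) hss (by omega)
    have h2 := hsmall C subset_rfl (by omega)
    have h3 : ∑ j ∈ T, bitRelu K (U j) S ≤
        ∑ j ∈ T, (bitRelu K (U j) (S \ C) + bitRelu K (U j) C) := by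
      refine Finset.sum_le_sum fun j _ => ?_
      unfold bitRelu
      rw [← Finset.sum_sdiff hCS]
      exact relu_add_le _ _
    rw [Finset.sum_add_distrib] at h3
    have h4 : (S.card : ℝ) = (S \ C).card + C.card := by
      rw [← Nat.cast_add, Finset.card_sdiff_add_card_eq_card hCS]
    rw [h4, add_div, add_mul]
    linarith

theorem value_bitNetwork (K : ℕ) {P R : Finset (Fin n)} (hPR : Disjoint P R) (U : BitMatrix n)
    (x : Cube n) :
    (bitNetwork K P R U).value x =
      3 / 4 * ∑ j ∈ P, bitRelu K (U j) (support x) - ∑ j ∈ R, bitRelu K (U j) (support x) -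
        linearWeight K * (P ∪ R)ᶜ.card * (support x).card := by
  rw [Network.value_eq, ← Finset.sum_add_sum_compl (P ∪ R), Finset.sum_union hPR]
  have hP : ∀ j ∈ P, ((bitNetwork K P R U).w j : ℝ) *
      relu (∑ i ∈ support x, ((bitNetwork K P R U).A j i : ℝ)) =
        3 / 4 * bitRelu K (U j) (support x) := by
    intro j hj
    simp [bitNetwork, hj, bitRelu]
  have hR : ∀ j ∈ R, ((bitNetwork K P R U).w j : ℝ) *
      relu (∑ i ∈ support x, ((bitNetwork K P R U).A j i : ℝ)) =
        -bitRelu K (U j) (support x) := by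
    intro j hj
    have hj' : j ∉ P := Finset.disjoint_right.1 hPR hj
    simp [bitNetwork, hj, hj', bitRelu]
  have hO : ∀ j ∈ (P ∪ R)ᶜ, ((bitNetwork K P R U).w j : ℝ) *
      relu (∑ i ∈ support x, ((bitNetwork K P R U).A j i : ℝ)) =
        -(linearWeight K * (support x).card) := by
    intro j hj
    simp only [Finset.mem_compl, Finset.mem_union, not_or] at hj
    simp [bitNetwork, hj.1, hj.2, relu]
  rw [Finset.sum_congr rfl hP, Finset.sum_congr rfl hR, Finset.sum_congr rfl hO]
  simp only [Finset.sum_neg_distrib, ← Finset.mul_sum, Finset.sum_const, nsmul_eq_mul]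
  ring

/-- If the bits are balanced then the network computes the constant `0`-function: on small inputs
the negative rows `R` outweigh the positive rows `P`, on large ones the remaining rows do. -/
theorem compute_bitNetwork {K : ℕ} (hK : 0 < K) {P R : Finset (Fin n)} (hPR : Disjoint P R)
    {h : ℕ} (hP : P.card = h) (hR : R.card = h) (hO : h ≤ (P ∪ R)ᶜ.card) {U : BitMatrix n}
    (hUP : Balanced U P (2 * K) ((1 / 2) ^ (2 * K) / 8))
    (hUR : Balanced U R (2 * K) ((1 / 2) ^ (2 * K) / 8)) :
    (bitNetwork K P R U).compute = zeroFunction n := by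
  funext x
  simp only [Network.compute, zeroFunction, decide_eq_false_iff_not, not_lt]
  rw [value_bitNetwork K hPR]
  set S := support x
  set q : ℝ := (1 / 2) ^ (2 * K) with hq
  have hq0 : 0 < q := by positivity
  have hK0 : (0 : ℝ) < 4 * K := by positivity
  have hh0 : (0 : ℝ) ≤ h := by positivity
  have hO' : (h : ℝ) ≤ (P ∪ R)ᶜ.card := by exact_mod_cast hO
  have hlin : (linearWeight K : ℝ) = q / (4 * K) := rfl
  have hs0 : (0 : ℝ) ≤ S.card / (4 * K) := by positivity
  have hOS : (S.card : ℝ) / (4 * K) * (q * h) ≤ linearWeight K * (P ∪ R)ᶜ.card * S.card := by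
    rw [hlin]
    calc (S.card : ℝ) / (4 * K) * (q * h) = q / (4 * K) * h * S.card := by ring
      _ ≤ _ := by gcongr
  have hR0 : 0 ≤ ∑ j ∈ R, bitRelu K (U j) S :=
    Finset.sum_nonneg fun j _ => le_max_left _ _
  rcases le_or_gt (2 * K) S.card with hS | hS
  -- A large input: the rows outside of `P ∪ R` suffice.
  · have h1 := sum_bitRelu_le hK U P (g := 9 / 8 * q * h) (fun C hC => by
      have := (abs_le.1 (hUP C hC.le)).2
      rw [hP, hC, ← hq] at this
      linarith) S hS
    have h2 : (S.card : ℝ) / (4 * K) * (9 / 8 * q * h) =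
        9 / 8 * ((S.card : ℝ) / (4 * K) * (q * h)) := by ring
    have h3 : 0 ≤ (S.card : ℝ) / (4 * K) * (q * h) := by positivity
    linarith
  -- A small input: the rows in `R` suffice, as `3 / 4 * (1 + 1 / 8) ≤ 1 - 1 / 8`.
  · rw [sum_bitRelu_of_card_le hK U P (by omega), sum_bitRelu_of_card_le hK U R (by omega)]
    have h1 := (abs_le.1 (hUP S hS.le)).2
    have h2 := (abs_le.1 (hUR S hS.le)).1
    rw [hP] at h1
    rw [hR] at h2
    have h3 : q ≤ (1 / 2) ^ S.card := pow_le_pow_of_le_one (by norm_num) (by norm_num) hS.le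
    have h4 : q * h ≤ (1 / 2) ^ S.card * h := by gcongr
    have h5 : 3 / 4 * ((zeroRows U P S).card : ℝ) - (zeroRows U R S).card ≤ 0 := by linarith
    have h6 : (S.card : ℝ) / (4 * K) *
        (3 / 4 * ((zeroRows U P S).card : ℝ) - (zeroRows U R S).card) ≤ 0 :=
      mul_nonpos_of_nonneg_of_nonpos hs0 h5
    have h7 : 0 ≤ (S.card : ℝ) / (4 * K) * (q * h) := by positivity
    linarith

/-- If the positive rows vanish on `B` twice as often as independent bits would, then the value at
the indicator of `B` is positive, of order `h`. -/
theorem value_indicator_ge {K : ℕ} (hK : 3 ≤ K) {P R : Finset (Fin n)} (hPR : Disjoint P R)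
    {h : ℕ} (hO : (P ∪ R)ᶜ.card ≤ 2 * h) {V : BitMatrix n} {B : Finset (Fin n)} (hB : B.card = K)
    (hP : ((1 / 2 : ℝ) ^ (K - 1) - (1 / 2) ^ (2 * K) / 8) * h ≤ (zeroRows V P B).card)
    (hR : ((zeroRows V R B).card : ℝ) ≤ ((1 / 2 : ℝ) ^ K + (1 / 2) ^ (2 * K) / 8) * h) :
    h * (1 / 2) ^ K / 32 ≤ (bitNetwork K P R V).value (indicator B) := by
  rw [value_bitNetwork K hPR, support_indicator, sum_bitRelu_of_card_le (by omega) V P (by omega),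
    sum_bitRelu_of_card_le (by omega) V R (by omega), hB]
  have hK0 : (K : ℝ) ≠ 0 := by
    have : K ≠ 0 := by omega
    exact_mod_cast this
  set p : ℝ := (1 / 2) ^ K with hp
  have hp0 : 0 < p := by positivity
  have hp8 : p ≤ 1 / 8 := by
    calc p ≤ (1 / 2 : ℝ) ^ 3 := pow_le_pow_of_le_one (by norm_num) (by norm_num) hK
      _ = 1 / 8 := by norm_num
  have h1 : (1 / 2 : ℝ) ^ (K - 1) = 2 * p := by
    obtain ⟨k, rfl⟩ : ∃ k, K = k + 1 := ⟨K - 1, by omega⟩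
    rw [hp, Nat.add_sub_cancel, pow_succ]; ring
  have h2 : (1 / 2 : ℝ) ^ (2 * K) = p ^ 2 := by rw [hp, ← pow_mul, mul_comm]
  have h3 : (K : ℝ) / (4 * K) = 1 / 4 := by field_simp
  have h4 : (linearWeight K : ℝ) * (P ∪ R)ᶜ.card * K = p ^ 2 / 4 * (P ∪ R)ᶜ.card := by
    show (1 / 2 : ℝ) ^ (2 * K) / (4 * K) * (P ∪ R)ᶜ.card * K = _
    rw [h2]; field_simp
  have h5 : p ^ 2 / 4 * ((P ∪ R)ᶜ.card : ℝ) ≤ p ^ 2 / 4 * (2 * h) := by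
    have : ((P ∪ R)ᶜ.card : ℝ) ≤ 2 * h := by exact_mod_cast hO
    gcongr
  rw [h1, h2] at hP
  rw [h2] at hR
  rw [h3, h4]
  have h6 : p ^ 2 * h ≤ 1 / 8 * p * h := by
    have : p ^ 2 ≤ 1 / 8 * p := by nlinarith
    gcongr
  have h7 : 0 ≤ p * h := by positivity
  nlinarith

/-! ### Farness -/

theorem relu_nonneg (a : ℝ) : 0 ≤ relu a := le_max_left _ _

theorem abs_relu_sub_le (a b : ℝ) : |relu a - relu b| ≤ |a - b| := by
  simpa [relu] using abs_max_sub_max_le_max 0 a 0 b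

theorem Weight.abs_le_one (a : Weight) : |(a : ℝ)| ≤ 1 := abs_le.2 a.2

theorem Weight.abs_sub_le (a b : Weight) : |(a : ℝ) - b| ≤ 2 * if a ≠ b then 1 else 0 := by
  split_ifs with h
  · have := a.2; have := b.2
    simp only [Set.mem_Icc] at *
    rw [abs_le]; constructor <;> linarith
  · push Not at h
    simp [h]

/-- Changing weights changes the value by at most twice the number of changed entries in the active
columns plus twice the number of active inputs for every changed output weight. -/
theorem Network.value_sub_le {m : ℕ} (G G' : Network n m) (x : Cube n) :
    G.value x - G'.value x ≤
      2 * (∑ i ∈ support x, (Finset.univ.filter fun j => G'.A j i ≠ G.A j i).card : ℕ) +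
      2 * (support x).card * (Finset.univ.filter fun j => G'.w j ≠ G.w j).card := by
  set S := support x
  rw [Network.value_eq, Network.value_eq, ← Finset.sum_sub_distrib]
  have hrow : ∀ j, (G.w j : ℝ) * relu (∑ i ∈ S, (G.A j i : ℝ)) -
      (G'.w j : ℝ) * relu (∑ i ∈ S, (G'.A j i : ℝ)) ≤
        ∑ i ∈ S, (2 * if G'.A j i ≠ G.A j i then 1 else 0) +
        2 * S.card * (if G'.w j ≠ G.w j then 1 else 0) := by
    intro j
    set a := ∑ i ∈ S, (G.A j i : ℝ)
    set a' := ∑ i ∈ S, (G'.A j i : ℝ)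
    have h1 : |relu a' - relu a| ≤ ∑ i ∈ S, (2 * if G'.A j i ≠ G.A j i then 1 else 0) := by
      refine (abs_relu_sub_le _ _).trans ?_
      simp only [a, a', ← Finset.sum_sub_distrib]
      exact (Finset.abs_sum_le_sum_abs _ _).trans
        (Finset.sum_le_sum fun i _ => Weight.abs_sub_le _ _)
    have h2 : relu a ≤ S.card := by
      refine max_le (by positivity) ?_
      calc a ≤ S.card • (1 : ℝ) := Finset.sum_le_card_nsmul _ _ _ fun i _ => (G.A j i).2.2
        _ = S.card := by simp
    have h3 := Weight.abs_sub_le (G'.w j) (G.w j)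
    calc (G.w j : ℝ) * relu a - (G'.w j : ℝ) * relu a'
        = -((G'.w j : ℝ) * (relu a' - relu a)) + -(((G'.w j : ℝ) - G.w j) * relu a) := by ring
      _ ≤ |(G'.w j : ℝ) * (relu a' - relu a)| + |((G'.w j : ℝ) - G.w j) * relu a| :=
          add_le_add (neg_le_abs _) (neg_le_abs _)
      _ = |(G'.w j : ℝ)| * |relu a' - relu a| + |(G'.w j : ℝ) - G.w j| * relu a := by
          rw [abs_mul, abs_mul, abs_of_nonneg (relu_nonneg a)]
      _ ≤ 1 * (∑ i ∈ S, (2 * if G'.A j i ≠ G.A j i then 1 else 0)) +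
            (2 * if G'.w j ≠ G.w j then 1 else 0) * S.card := by
          gcongr
          · exact Weight.abs_le_one _
          · exact relu_nonneg a
      _ = _ := by ring
  refine (Finset.sum_le_sum fun j _ => hrow j).trans (le_of_eq ?_)
  rw [Finset.sum_add_distrib, Finset.sum_comm, ← Finset.mul_sum]
  simp only [← Finset.mul_sum]
  push_cast
  simp only [Finset.natCast_card_filter]

/-- The uniform distribution on the indicators of the sets `B t`. -/
noncomputable def blockDistribution {ι : Type*} [Fintype ι] [Nonempty ι]
    (B : ι → Finset (Fin n)) : PMF (Cube n) :=
  (PMF.uniformOfFintype ι).map fun t => indicator (B t)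

/-- If the values at the indicators of many disjoint blocks are large, then few changes cannot make
more than half of them nonpositive. -/
theorem farFrom_of_blocks {ι : Type*} [Fintype ι] [Nonempty ι] {m : ℕ} (G : Network n m)
    (B : ι → Finset (Fin n)) {K : ℕ} (hB : ∀ t, (B t).card = K)
    (hdisj : Pairwise fun s t => Disjoint (B s) (B t)) {v ε δ : ℝ}
    (hv : ∀ t, v ≤ G.value (indicator (B t))) (hδ : δ < 1 / 2)
    (hpos : 0 < v / 2 - K * (ε * m))
    (hmany : 2 * (ε * n * m) ≤ Fintype.card ι * (v / 2 - K * (ε * m))) :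
    G.FarFrom ε δ (blockDistribution B) (zeroFunction n) := by
  classical
  rintro ⟨G', hA, hw, hD⟩
  set E : Fin n → ℕ := fun i => (Finset.univ.filter fun j => G'.A j i ≠ G.A j i).card
  -- The total number of changed entries, summed column by column.
  have hE : ((∑ i, E i : ℕ) : ℝ) ≤ ε * n * m := by
    refine le_trans (le_of_eq ?_) hA
    congr 1
    rw [Set.ncard_eq_toFinset_card', Finset.card_eq_sum_card_fiberwise (f := fun p => p.2)
      (t := Finset.univ) (by simp)]
    refine Finset.sum_congr rfl fun i _ => ?_
    refine Finset.card_bij (fun j _ => (j, i)) ?_ ?_ ?_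
    · intro j hj; simpa using hj
    · intro a _ b _ h; exact (Prod.mk.inj h).1
    · rintro ⟨j, i'⟩ h
      simp only [Finset.mem_filter, Set.mem_toFinset, Set.mem_ofPred_eq] at h
      obtain ⟨h1, rfl⟩ := h
      exact ⟨j, by simpa using h1, rfl⟩
  have hw' : ((Finset.univ.filter fun j => G'.w j ≠ G.w j).card : ℝ) ≤ ε * m := by
    refine le_trans (le_of_eq ?_) hw
    congr 1
    rw [Set.ncard_eq_toFinset_card']
    congr 1
    ext j; simp
  set Z := Finset.univ.filter fun t => G'.value (indicator (B t)) ≤ 0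
  have hZ : ∀ t ∈ Z, v / 2 - K * (ε * m) ≤ ((∑ i ∈ B t, E i : ℕ) : ℝ) := by
    intro t ht
    have h1 := G.value_sub_le G' (indicator (B t))
    rw [support_indicator, hB t] at h1
    have h2 := hv t
    have h3 : G'.value (indicator (B t)) ≤ 0 := (Finset.mem_filter.1 ht).2
    have h4 : (2 : ℝ) * K * (Finset.univ.filter fun j => G'.w j ≠ G.w j).card ≤
        2 * K * (ε * m) := by gcongr
    linarith
  have hsum : (Z.card : ℝ) * (v / 2 - K * (ε * m)) ≤ ε * n * m := by
    calc (Z.card : ℝ) * (v / 2 - K * (ε * m)) = ∑ t ∈ Z, (v / 2 - K * (ε * m)) := by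
          rw [Finset.sum_const, nsmul_eq_mul]
      _ ≤ ∑ t ∈ Z, ((∑ i ∈ B t, E i : ℕ) : ℝ) := Finset.sum_le_sum hZ
      _ = ((∑ i ∈ Z.biUnion B, E i : ℕ) : ℝ) := by
          rw [← Nat.cast_sum, Finset.sum_biUnion fun s _ t _ hst => hdisj hst]
      _ ≤ ((∑ i, E i : ℕ) : ℝ) :=
          Nat.cast_le.2 (Finset.sum_le_sum_of_subset (Finset.subset_univ _))
      _ ≤ _ := hE
  have hhalf : 2 * (Z.card : ℝ) ≤ Fintype.card ι := by
    by_contra hcon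
    push Not at hcon
    have := mul_lt_mul_of_pos_right hcon hpos
    linarith
  have hcomp : (Fintype.card ι : ℝ) / 2 ≤ (Zᶜ.card : ℝ) := by
    rw [Finset.card_compl, Nat.cast_sub (Finset.card_le_univ _)]
    linarith
  have hmeas : ENNReal.ofReal (1 / 2) ≤
      (blockDistribution B).toMeasure {x | G'.compute x ≠ zeroFunction n x} := by
    refine le_trans ?_ (PMF.toOuterMeasure_apply_le_toMeasure_apply _ _)
    rw [blockDistribution, PMF.toOuterMeasure_map_apply, PMF.toOuterMeasure_uniformOfFintype_apply]
    have hset : Fintype.card ((fun t => indicator (B t)) ⁻¹'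
        {x | G'.compute x ≠ zeroFunction n x}) = Zᶜ.card := by
      rw [← Set.toFinset_card]
      congr 1
      ext t
      simp [Z, Network.compute, zeroFunction]
    rw [hset]
    have hc : (0 : ℝ) < Fintype.card ι := by exact_mod_cast Fintype.card_pos
    rw [← ENNReal.ofReal_natCast, ← ENNReal.ofReal_natCast, ← ENNReal.ofReal_div_of_pos hc]
    refine ENNReal.ofReal_le_ofReal ?_
    rw [le_div_iff₀ hc]
    linarith
  have := (ENNReal.ofReal_le_ofReal_iff' ).1 (hmeas.trans hD)
  rcases this with h | h <;> linarith

/-! ### Hidden blocks of columns and their parities -/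

section Blocks

variable {K N : ℕ} (e : Fin K × ZMod N ↪ Fin n) (r : Fin K → ZMod N)

/-- The column number `a` of the block `t`. The columns are arranged in a grid by `e`, and a block
consists of one column of each of the `K` lines, displaced by the secret shift `r`. -/
def blockColumn (t : ZMod N) (a : Fin K) : Fin n := e (a, t + r a)

theorem blockColumn_inj {t t' : ZMod N} {a a' : Fin K} :
    blockColumn e r t a = blockColumn e r t' a' ↔ t = t' ∧ a = a' := by
  simp only [blockColumn, e.injective.eq_iff, Prod.mk.injEq]
  constructor
  · rintro ⟨rfl, h⟩; exact ⟨add_right_cancel h, rfl⟩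
  · rintro ⟨rfl, rfl⟩; exact ⟨rfl, rfl⟩

/-- The set of columns of the block `t`. -/
def block (t : ZMod N) : Finset (Fin n) := Finset.univ.image (blockColumn e r t)

theorem card_block (t : ZMod N) : (block e r t).card = K := by
  rw [block, Finset.card_image_of_injective _ fun a b h => ((blockColumn_inj e r).1 h).2,
    Finset.card_univ, Fintype.card_fin]

theorem block_disjoint : Pairwise fun s t => Disjoint (block e r s) (block e r t) := by
  intro s t hst
  rw [Finset.disjoint_left]
  intro i hs ht
  simp only [block, Finset.mem_image, Finset.mem_univ, true_and] at hs ht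
  obtain ⟨a, rfl⟩ := hs
  obtain ⟨b, h⟩ := ht
  exact hst ((blockColumn_inj e r).1 h).1.symm

/-- The set `Q` of columns contains a whole block. -/
def ContainsBlock (Q : Finset (Fin n)) : Prop := ∃ t, ∀ a, blockColumn e r t a ∈ Q

open Classical in
/-- A choice, for each block, of a column outside of `Q`, if there is one. -/
noncomputable def freeColumn (a₀ : Fin K) (Q : Finset (Fin n)) (t : ZMod N) : Fin K :=
  if h : ∃ a, blockColumn e r t a ∉ Q then h.choose else a₀

theorem blockColumn_freeColumn_notMem (a₀ : Fin K) {Q : Finset (Fin n)}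
    (hQ : ¬ ContainsBlock e r Q) (t : ZMod N) :
    blockColumn e r t (freeColumn e r a₀ Q t) ∉ Q := by
  have h : ∃ a, blockColumn e r t a ∉ Q := by
    simp only [ContainsBlock, not_exists, not_forall] at hQ
    exact hQ t
  rw [freeColumn, dif_pos h]
  exact h.choose_spec

variable (P : Finset (Fin n))

/-- The parity of the bits of row `j` in the block `t`, if `j` is one of the rows in `P`. -/
def syndrome (U : BitMatrix n) (j : Fin n) (t : ZMod N) : ZMod 2 :=
  if j ∈ P then ∑ a, U j (blockColumn e r t a) else 0

theorem syndrome_of_notMem (U : BitMatrix n) : ∀ j ∉ P, ∀ t, syndrome e r P U j t = 0 :=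
  fun j hj t => by simp [syndrome, hj]

variable [NeZero N]

open Classical in
/-- Few columns rarely contain a block of a random displacement: of the `N ^ K` shifts, at most
`N * q ^ K` are bad for a set of `q` columns. -/
theorem card_containsBlock_le (Q : Finset (Fin n)) :
    (Finset.univ.filter fun r : Fin K → ZMod N => ContainsBlock e r Q).card ≤ N * Q.card ^ K := by
  have h : (Finset.univ.filter fun r : Fin K → ZMod N => ContainsBlock e r Q) ⊆
      Finset.univ.biUnion fun t : ZMod N => Fintype.piFinset fun a : Fin K =>
        Finset.univ.filter fun x : ZMod N => e (a, t + x) ∈ Q := by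
    intro r hr
    obtain ⟨t, ht⟩ := (Finset.mem_filter.1 hr).2
    exact Finset.mem_biUnion.2 ⟨t, Finset.mem_univ _, by simpa [blockColumn] using ht⟩
  refine (Finset.card_le_card h).trans
    ((Finset.card_biUnion_le_card_mul _ _ (Q.card ^ K) fun t _ => ?_).trans (by simp [ZMod.card]))
  rw [Fintype.card_piFinset]
  calc ∏ a : Fin K, (Finset.univ.filter fun x : ZMod N => e (a, t + x) ∈ Q).card
      ≤ ∏ _a : Fin K, Q.card := by
        refine Finset.prod_le_prod' fun a _ => ?_
        refine Finset.card_le_card_of_injOn (fun x => e (a, t + x)) (fun x hx => ?_) ?_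
        · simpa using hx
        · intro x _ y _ hxy
          simpa using hxy
    _ = Q.card ^ K := by simp

/-- A bit of a random block indicator is rarely `1`. -/
theorem sum_blockDistribution_le (i : Fin n) :
    ∑ y, blockDistribution (block e r) y * (if y i then 1 else 0) ≤ (N : ℝ≥0∞)⁻¹ := by
  classical
  have h1 : ∑ y, blockDistribution (block e r) y * (if y i then 1 else 0) =
      (blockDistribution (block e r)).toOuterMeasure {y | y i = true} := by
    rw [PMF.toOuterMeasure_apply_fintype]
    refine Finset.sum_congr rfl fun y _ => ?_
    by_cases h : y i = true <;> simp [h]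
  rw [h1, blockDistribution, PMF.toOuterMeasure_map_apply,
    PMF.toOuterMeasure_uniformOfFintype_apply, ZMod.card, ENNReal.div_eq_inv_mul]
  refine mul_le_of_le_one_right' ?_
  rw [← Nat.cast_one, Nat.cast_le, ← Set.toFinset_card, Finset.card_le_one]
  intro s hs t ht
  simp only [Set.mem_toFinset, Set.mem_preimage, Set.mem_ofPred_eq, indicator,
    decide_eq_true_eq] at hs ht
  by_contra hst
  exact Finset.disjoint_left.1 (block_disjoint e r hst) hs ht

/-- Add the bit `s j t` to the entry of row `j` in one column of the block `t`, chosen by `κ`. -/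
def shiftBits (κ : ZMod N → Fin K) (s : Fin n → ZMod N → ZMod 2) (U : BitMatrix n) : BitMatrix n :=
  fun j i => U j i + ∑ t, if blockColumn e r t (κ t) = i then s j t else 0

theorem shiftBits_blockColumn (κ : ZMod N → Fin K) (s : Fin n → ZMod N → ZMod 2)
    (U : BitMatrix n) (j : Fin n) (t : ZMod N) (a : Fin K) :
    shiftBits e r κ s U j (blockColumn e r t a) =
      U j (blockColumn e r t a) + if κ t = a then s j t else 0 := by
  simp only [shiftBits, blockColumn_inj]
  congr 1
  rw [Finset.sum_eq_single t]
  · simp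
  · intro b _ hb; simp [hb]
  · simp

theorem shiftBits_of_ne {κ : ZMod N → Fin K} (s : Fin n → ZMod N → ZMod 2)
    (U : BitMatrix n) (j : Fin n) {i : Fin n} (h : ∀ t, blockColumn e r t (κ t) ≠ i) :
    shiftBits e r κ s U j i = U j i := by
  simp [shiftBits, h]

theorem shiftBits_shiftBits (κ : ZMod N → Fin K) (s : Fin n → ZMod N → ZMod 2)
    (U : BitMatrix n) : shiftBits e r κ s (shiftBits e r κ s U) = U := by
  funext j i
  simp only [shiftBits, add_assoc, CharTwo.add_self_eq_zero, add_zero]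

theorem syndrome_shiftBits (κ : ZMod N → Fin K) {s : Fin n → ZMod N → ZMod 2}
    (hs : ∀ j ∉ P, ∀ t, s j t = 0) (U : BitMatrix n) :
    syndrome e r P (shiftBits e r κ s U) = syndrome e r P U + s := by
  funext j t
  simp only [syndrome, Pi.add_apply]
  split_ifs with h
  · simp [shiftBits_blockColumn, Finset.sum_add_distrib]
  · simp [hs j h t]

/-- Make all parities of the rows in `P` even, by changing the columns number `a₀` of the blocks. -/
def repair (a₀ : Fin K) (U : BitMatrix n) : BitMatrix n :=
  shiftBits e r (fun _ => a₀) (syndrome e r P U) U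

/-- In a row with even parity, the last bit of a block vanishes as soon as the other ones do. -/
theorem zeroRows_repair (a₀ : Fin K) (U : BitMatrix n) (t : ZMod N) :
    zeroRows (repair e r P a₀ U) P (block e r t) =
      zeroRows U P ((block e r t).erase (blockColumn e r t a₀)) := by
  ext j
  simp only [zeroRows, Finset.mem_filter]
  refine and_congr_right fun hj => ?_
  have hU : ∀ a, repair e r P a₀ U j (blockColumn e r t a) = U j (blockColumn e r t a) +
      if a₀ = a then ∑ b, U j (blockColumn e r t b) else 0 := by
    intro a
    simp [repair, shiftBits_blockColumn, syndrome, hj]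
  simp only [block, Finset.mem_image, Finset.mem_univ, true_and, forall_exists_index,
    forall_apply_eq_imp_iff, Finset.mem_erase, and_imp, hU]
  constructor
  · rintro h i hi a rfl
    have ha : a₀ ≠ a := fun h' => hi (by rw [h'])
    simpa [ha] using h a
  · intro h a
    have h' : ∀ b, b ≠ a₀ → U j (blockColumn e r t b) = 0 := fun b hb =>
      h _ (fun h' => hb ((blockColumn_inj e r).1 h').2) b rfl
    have hsum : ∑ b, U j (blockColumn e r t b) = U j (blockColumn e r t a₀) :=
      Finset.sum_eq_single a₀ (fun b _ hb => h' b hb) (by simp)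
    rw [hsum]
    split_ifs with ha
    · rw [ha, CharTwo.add_self_eq_zero]
    · rw [h' a (Ne.symm ha), add_zero]

theorem zeroRows_repair_of_disjoint {R : Finset (Fin n)} (hPR : Disjoint P R) (a₀ : Fin K)
    (U : BitMatrix n) (S : Finset (Fin n)) :
    zeroRows (repair e r P a₀ U) R S = zeroRows U R S := by
  refine Finset.filter_congr fun j hj => ?_
  have hj' : j ∉ P := Finset.disjoint_right.1 hPR hj
  simp [repair, shiftBits, syndrome, hj']

open Classical in
/-- A procedure that does not read a whole block gives the same output on as many bit matrices as
on repaired ones. Instead of the fixed column of a block, a column that is not read can be changed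
to make the parity even; the procedure does not notice this, and the change can be undone, because
the columns that are not read are still known afterwards. -/
theorem card_not_containsBlock_le (a₀ : Fin K) (cols : BitMatrix n → Finset (Fin n))
    (out : BitMatrix n → Bool)
    (hcongr : ∀ U U' : BitMatrix n, (∀ i ∈ cols U, ∀ j, U j i = U' j i) →
      out U' = out U ∧ cols U' = cols U) (b : Bool) :
    (Finset.univ.filter fun U => ¬ ContainsBlock e r (cols U) ∧ out U = b).card ≤
      (Finset.univ.filter fun U => out (repair e r P a₀ U) = b).card := by
  -- `even U` has even parities, and `f U` is the matrix with the parities of `U` whose repair is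
  -- `even U`.
  let even : BitMatrix n → BitMatrix n := fun U =>
    shiftBits e r (freeColumn e r a₀ (cols U)) (syndrome e r P U) U
  let f : BitMatrix n → BitMatrix n := fun U =>
    shiftBits e r (fun _ => a₀) (syndrome e r P U) (even U)
  have hsyn_even : ∀ U, syndrome e r P (even U) = 0 := by
    intro U
    rw [syndrome_shiftBits e r P _ (syndrome_of_notMem e r P U)]
    funext j t
    exact CharTwo.add_self_eq_zero _
  have hsyn : ∀ U, syndrome e r P (f U) = syndrome e r P U := by
    intro U
    rw [syndrome_shiftBits e r P _ (syndrome_of_notMem e r P U), hsyn_even, zero_add]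
  have hrep : ∀ U, repair e r P a₀ (f U) = even U := by
    intro U
    rw [repair, hsyn, shiftBits_shiftBits]
  have heven : ∀ U, ¬ ContainsBlock e r (cols U) →
      out (even U) = out U ∧ cols (even U) = cols U := by
    intro U hU
    refine hcongr U _ fun i hi j => ?_
    refine (shiftBits_of_ne e r _ _ j fun t ht => ?_).symm
    exact blockColumn_freeColumn_notMem e r a₀ hU t (ht ▸ hi)
  refine Finset.card_le_card_of_injOn f ?_ ?_
  · intro U hU
    simp only [Finset.coe_filter, Finset.mem_univ, true_and, Set.mem_ofPred_eq] at hU ⊢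
    rw [hrep, (heven U hU.1).1, hU.2]
  · intro U hU U' hU' h
    simp only [Finset.coe_filter, Finset.mem_univ, true_and, Set.mem_ofPred_eq] at hU hU'
    have h1 : even U = even U' := by rw [← hrep U, ← hrep U', h]
    have h2 : syndrome e r P U = syndrome e r P U' := by rw [← hsyn U, ← hsyn U', h]
    have h3 : cols U = cols U' := by
      rw [← (heven U hU.1).2, ← (heven U' hU'.1).2, h1]
    simp only [even] at h1
    rw [← h2, ← h3] at h1
    rw [← shiftBits_shiftBits e r (freeColumn e r a₀ (cols U)) (syndrome e r P U) U, h1,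
      shiftBits_shiftBits]

end Blocks

/-! ### Indistinguishability -/

section Indistinguishability

variable {K N : ℕ} [NeZero N] (e : Fin K × ZMod N ↪ Fin n) (P R : Finset (Fin n)) (a₀ : Fin K)

theorem bitNetwork_congr {K : ℕ} {P R : Finset (Fin n)} {U U' : BitMatrix n} {i j : Fin n}
    (h : U j i = U' j i) : (bitNetwork K P R U).A j i = (bitNetwork K P R U').A j i := by
  simp [bitNetwork, h]

open Classical in
/-- For a fixed shift, a strategy whose sample bits are answered by `0` tells the networks of the
bits `U` from those of the repaired bits only as often as it reads a whole block. -/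
theorem card_zeroOutput_add_le (r : Fin K → ZMod N) (σ : Strategy n n) :
    (Finset.univ.filter fun U : BitMatrix n =>
        σ.zeroOutput (bitNetwork K P R U) = true).card +
      (Finset.univ.filter fun U : BitMatrix n =>
        σ.zeroOutput (bitNetwork K P R (repair e r P a₀ U)) = false).card ≤
      Fintype.card (BitMatrix n) + (Finset.univ.filter fun U : BitMatrix n =>
        ContainsBlock e r (σ.zeroColumns (bitNetwork K P R U))).card := by
  have h1 := card_not_containsBlock_le e r P a₀ (fun U => σ.zeroColumns (bitNetwork K P R U))
    (fun U => σ.zeroOutput (bitNetwork K P R U))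
    (fun U U' h => σ.zero_run_congr (G := bitNetwork K P R U) (G' := bitNetwork K P R U') rfl
      fun i hi j => bitNetwork_congr (h i hi j)) true
  have h2 : (Finset.univ.filter fun U : BitMatrix n =>
        σ.zeroOutput (bitNetwork K P R U) = true).card ≤
      (Finset.univ.filter fun U : BitMatrix n =>
        ¬ ContainsBlock e r (σ.zeroColumns (bitNetwork K P R U)) ∧
          σ.zeroOutput (bitNetwork K P R U) = true).card +
      (Finset.univ.filter fun U : BitMatrix n =>
        ContainsBlock e r (σ.zeroColumns (bitNetwork K P R U))).card := by
    refine (Finset.card_le_card fun U hU => ?_).trans (Finset.card_union_le _ _)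
    simp only [Finset.mem_filter, Finset.mem_univ, true_and, Finset.mem_union] at hU ⊢
    tauto
  have h3 := Finset.card_filter_add_card_filter_not (s := (Finset.univ : Finset (BitMatrix n)))
    (fun U => σ.zeroOutput (bitNetwork K P R (repair e r P a₀ U)) = true)
  simp only [Bool.not_eq_true, Finset.card_univ] at h3
  omega

/-- Summed over all bit matrices and all shifts, the probability of accepting the network of the
bits plus that of rejecting the network of the repaired bits is hardly more than the number of
pairs, so that a strategy with few queries has no advantage over guessing. -/
theorem sum_outputProb_le (σ : Strategy n n) {q : ℕ} (hq : σ.QueriesAtMost q) :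
    ∑ r : Fin K → ZMod N, ∑ U : BitMatrix n,
      (σ.outputProb (bitNetwork K P R U) (blockDistribution (block e r)) true (fun _ => none) +
        σ.outputProb (bitNetwork K P R (repair e r P a₀ U)) (blockDistribution (block e r)) false
          (fun _ => none)) ≤
      Fintype.card (BitMatrix n) *
        ((N : ℝ≥0∞) ^ K * (1 + 2 * (q * (N : ℝ≥0∞)⁻¹)) + N * (q : ℝ≥0∞) ^ K) := by
  classical
  set M := Fintype.card (BitMatrix n)
  set p : ℝ≥0∞ := q * (N : ℝ≥0∞)⁻¹
  have h1 : ∀ r : Fin K → ZMod N, ∑ U : BitMatrix n,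
      (σ.outputProb (bitNetwork K P R U) (blockDistribution (block e r)) true (fun _ => none) +
        σ.outputProb (bitNetwork K P R (repair e r P a₀ U)) (blockDistribution (block e r)) false
          (fun _ => none)) ≤
      M * (1 + 2 * p) + ((Finset.univ.filter fun U : BitMatrix n =>
        ContainsBlock e r (σ.zeroColumns (bitNetwork K P R U))).card : ℝ≥0∞) := by
    intro r
    calc _ ≤ ∑ U : BitMatrix n,
          (((if σ.zeroOutput (bitNetwork K P R U) = true then 1 else 0) + p) +
            ((if σ.zeroOutput (bitNetwork K P R (repair e r P a₀ U)) = false then 1 else 0) + p)) :=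
          Finset.sum_le_sum fun U _ => add_le_add
            (σ.outputProb_le_of_bits _ _ _ hq (sum_blockDistribution_le e r))
            (σ.outputProb_le_of_bits _ _ _ hq (sum_blockDistribution_le e r))
      _ = (((Finset.univ.filter fun U : BitMatrix n =>
            σ.zeroOutput (bitNetwork K P R U) = true).card +
          (Finset.univ.filter fun U : BitMatrix n =>
            σ.zeroOutput (bitNetwork K P R (repair e r P a₀ U)) = false).card : ℕ) : ℝ≥0∞) +
          M * (2 * p) := by
          simp only [Finset.sum_add_distrib, Finset.sum_boole, Finset.sum_const, Finset.card_univ,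
            nsmul_eq_mul, Nat.cast_add]
          ring
      _ ≤ _ := by
          grw [card_zeroOutput_add_le]
          push_cast
          rw [mul_add, mul_one]
          exact le_of_eq (add_right_comm _ _ _)
  have h2 : ∑ r : Fin K → ZMod N, (Finset.univ.filter fun U : BitMatrix n =>
      ContainsBlock e r (σ.zeroColumns (bitNetwork K P R U))).card ≤ M * (N * q ^ K) := by
    simp only [Finset.card_filter]
    rw [Finset.sum_comm]
    simp only [← Finset.card_filter]
    refine (Finset.sum_le_card_nsmul _ _ (N * q ^ K) fun U _ => ?_).trans (by simp [M])
    refine (card_containsBlock_le e _).trans ?_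
    gcongr
    exact σ.card_zeroColumns_le _ q hq
  calc _ ≤ ∑ r : Fin K → ZMod N, ((M : ℝ≥0∞) * (1 + 2 * p) +
        ((Finset.univ.filter fun U : BitMatrix n =>
          ContainsBlock e r (σ.zeroColumns (bitNetwork K P R U))).card : ℝ≥0∞)) :=
        Finset.sum_le_sum fun r _ => h1 r
    _ = (N : ℝ≥0∞) ^ K * (M * (1 + 2 * p)) + ((∑ r : Fin K → ZMod N,
        (Finset.univ.filter fun U : BitMatrix n =>
          ContainsBlock e r (σ.zeroColumns (bitNetwork K P R U))).card : ℕ) : ℝ≥0∞) := by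
        rw [Finset.sum_add_distrib]
        simp [ZMod.card]
    _ ≤ (N : ℝ≥0∞) ^ K * (M * (1 + 2 * p)) + ((M * (N * q ^ K) : ℕ) : ℝ≥0∞) := by
        gcongr
    _ = _ := by push_cast; ring

/-- If for most bits `U` the network of `U` computes the constant `0`-function and the networks of
the repaired bits are far from it, then a tester makes many queries. -/
theorem query_bound_of_good {ε δ : ℝ} (good : Finset (BitMatrix n))
    (hgood : 9 / 10 * (Fintype.card (BitMatrix n) : ℝ) ≤ good.card)
    (hyes : ∀ U ∈ good, (bitNetwork K P R U).compute = zeroFunction n)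
    (hno : ∀ U ∈ good, ∀ r, (bitNetwork K P R (repair e r P a₀ U)).FarFrom ε δ
      (blockDistribution (block e r)) (zeroFunction n))
    (T : RandomizedAlgorithm.{u} n n) {q : ℕ}
    (hT : T.IsDistributionFreeTester ε δ (zeroFunction n)) (hq : T.QueriesAtMost q) :
    6 / 5 * (N : ℝ) ^ K ≤ (N : ℝ) ^ K * (1 + 2 * (q / N)) + N * (q : ℝ) ^ K := by
  set M := Fintype.card (BitMatrix n)
  have hsum : ∑ r : Fin K → ZMod N, ∑ U : BitMatrix n,
      (T.outputProb (bitNetwork K P R U) (blockDistribution (block e r)) true +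
        T.outputProb (bitNetwork K P R (repair e r P a₀ U)) (blockDistribution (block e r)) false) ≤
      M * ((N : ℝ≥0∞) ^ K * (1 + 2 * (q * (N : ℝ≥0∞)⁻¹)) + N * (q : ℝ≥0∞) ^ K) := by
    simp only [RandomizedAlgorithm.outputProb]
    calc _ = ∫⁻ ω, ∑ r : Fin K → ZMod N, ∑ U : BitMatrix n,
          ((T.strategy ω).outputProb (bitNetwork K P R U) (blockDistribution (block e r)) true
            (fun _ => none) +
          (T.strategy ω).outputProb (bitNetwork K P R (repair e r P a₀ U))
            (blockDistribution (block e r)) false (fun _ => none)) ∂T.P := by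
          have hm : ∀ (r : Fin K → ZMod N) (U : BitMatrix n), Measurable fun ω =>
              (T.strategy ω).outputProb (bitNetwork K P R U) (blockDistribution (block e r)) true
                (fun _ => none) +
              (T.strategy ω).outputProb (bitNetwork K P R (repair e r P a₀ U))
                (blockDistribution (block e r)) false (fun _ => none) := fun r U =>
            (T.measurable_outputProb _ _ _).add (T.measurable_outputProb _ _ _)
          rw [MeasureTheory.lintegral_finsetSum _ fun r _ =>
            Finset.measurable_fun_sum _ fun U _ => hm r U]
          refine Finset.sum_congr rfl fun r _ => ?_
          rw [MeasureTheory.lintegral_finsetSum _ fun U _ => hm r U]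
          refine Finset.sum_congr rfl fun U _ => ?_
          rw [MeasureTheory.lintegral_add_left (T.measurable_outputProb _ _ _)]
      _ ≤ ∫⁻ _ω, M * ((N : ℝ≥0∞) ^ K * (1 + 2 * (q * (N : ℝ≥0∞)⁻¹)) + N * (q : ℝ≥0∞) ^ K) ∂T.P :=
          MeasureTheory.lintegral_mono fun ω => sum_outputProb_le e P R a₀ _ (hq ω)
      _ = _ := by rw [MeasureTheory.lintegral_const, MeasureTheory.measure_univ, mul_one]
  have hlow : (N : ℝ≥0∞) ^ K * (good.card * (2 / 3 + 2 / 3)) ≤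
      ∑ r : Fin K → ZMod N, ∑ U : BitMatrix n,
      (T.outputProb (bitNetwork K P R U) (blockDistribution (block e r)) true +
        T.outputProb (bitNetwork K P R (repair e r P a₀ U)) (blockDistribution (block e r))
          false) := by
    calc (N : ℝ≥0∞) ^ K * (good.card * (2 / 3 + 2 / 3))
        = ∑ _r : Fin K → ZMod N, ∑ _U ∈ good, ((2 : ℝ≥0∞) / 3 + 2 / 3) := by
          simp [ZMod.card, mul_add]
      _ ≤ _ := by
          refine Finset.sum_le_sum fun r _ => ?_
          refine le_trans (Finset.sum_le_sum fun U hU => ?_)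
            (Finset.sum_le_sum_of_subset (Finset.subset_univ good))
          exact add_le_add ((hT _ _).1 (hyes U hU)) ((hT _ _).2 (hno U hU r))
  have hN : (0 : ℝ) < N := by exact_mod_cast NeZero.pos N
  have hM0 : (0 : ℝ) < M := by
    have : 0 < M := Fintype.card_pos
    exact_mod_cast this
  -- For uniform guessing the sum of the two success probabilities is `1`; here it is at least
  -- `9 / 10 * (4 / 3) = 6 / 5` on average.
  have h := hlow.trans hsum
  -- Both sides are finite, so that the inequality can be read in the reals.
  have hreal : (N : ℝ) ^ K * (good.card * (2 / 3 + 2 / 3)) ≤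
      M * ((N : ℝ) ^ K * (1 + 2 * (q * (N : ℝ)⁻¹)) + N * (q : ℝ) ^ K) := by
    have hNi : (N : ℝ≥0∞)⁻¹ = ENNReal.ofReal (N : ℝ)⁻¹ := by
      rw [ENNReal.ofReal_inv_of_pos hN, ENNReal.ofReal_natCast]
    have h23 : (2 : ℝ≥0∞) / 3 = ENNReal.ofReal (2 / 3) := by
      rw [ENNReal.ofReal_div_of_pos (by norm_num)]
      norm_num
    have hc : ∀ a : ℕ, (a : ℝ≥0∞) = ENNReal.ofReal a := fun a => (ENNReal.ofReal_natCast a).symm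
    have hone : (1 : ℝ≥0∞) = ENNReal.ofReal 1 := by simp
    have htwo : (2 : ℝ≥0∞) = ENNReal.ofReal 2 := by simp
    rw [hNi, h23, hc N, hc good.card, hc M, hc q, hone, htwo] at h
    rw [← ENNReal.ofReal_pow hN.le, ← ENNReal.ofReal_pow (by positivity),
      ← ENNReal.ofReal_add (by norm_num) (by norm_num), ← ENNReal.ofReal_mul (by positivity),
      ← ENNReal.ofReal_mul (by positivity), ← ENNReal.ofReal_mul (by positivity),
      ← ENNReal.ofReal_mul (by positivity), ← ENNReal.ofReal_add (by norm_num) (by positivity),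
      ← ENNReal.ofReal_mul (by positivity), ← ENNReal.ofReal_mul (by positivity),
      ← ENNReal.ofReal_add (by positivity) (by positivity),
      ← ENNReal.ofReal_mul (by positivity)] at h
    exact (ENNReal.ofReal_le_ofReal_iff (by positivity)).1 h
  rw [← div_eq_mul_inv] at hreal
  refine le_of_mul_le_mul_left ?_ hM0
  refine le_trans ?_ hreal
  calc (M : ℝ) * (6 / 5 * (N : ℝ) ^ K) = (N : ℝ) ^ K * ((9 / 10 * M) * (2 / 3 + 2 / 3)) := by ring
    _ ≤ _ := by gcongr

end Indistinguishability

/-! ### Choice of the parameters -/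

open Filter in
theorem eventually_pow_mul_exp_le (d : ℕ) {b C : ℝ} (hb : 0 < b) (hC : 0 < C) :
    ∀ᶠ n : ℕ in atTop, ((n : ℝ) + 1) ^ d * Real.exp (-(b * n)) ≤ C := by
  have h := (isLittleO_pow_exp_pos_mul_atTop d hb).bound
    (show 0 < C * Real.exp (-b) by positivity)
  have ht : Tendsto (fun n : ℕ => (n : ℝ) + 1) atTop atTop :=
    tendsto_atTop_add_const_right _ _ tendsto_natCast_atTop_atTop
  filter_upwards [ht.eventually h] with n hn
  rw [Real.norm_of_nonneg (by positivity), Real.norm_of_nonneg (by positivity), mul_assoc,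
    ← Real.exp_add] at hn
  calc ((n : ℝ) + 1) ^ d * Real.exp (-(b * n))
      ≤ C * Real.exp (-b + b * (n + 1)) * Real.exp (-(b * n)) := by gcongr
    _ = C := by
        rw [mul_assoc, ← Real.exp_add]
        ring_nf
        simp

open Classical in
/-- Most bit matrices are balanced on two given sets of `n / 3` rows. -/
theorem exists_card_balanced_ge (d : ℕ) {η : ℝ} (hη : 0 < η) (hη1 : η ≤ 1) :
    ∃ n₀ : ℕ, ∀ n, n₀ ≤ n → ∀ P R : Finset (Fin n), P.card = n / 3 → R.card = n / 3 →
      9 / 10 * (Fintype.card (BitMatrix n) : ℝ) ≤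
        (Finset.univ.filter fun U : BitMatrix n => Balanced U P d η ∧ Balanced U R d η).card := by
  obtain ⟨n₁, hn₁⟩ := Filter.eventually_atTop.1
    (eventually_pow_mul_exp_le d (b := η ^ 2 / 16) (C := 1 / (40 * (d + 1)))
      (by positivity) (by positivity))
  refine ⟨max n₁ 12, fun n hn P R hP hR => ?_⟩
  have h12 : 12 ≤ n := (le_max_right _ _).trans hn
  have hexp := hn₁ n ((le_max_left _ _).trans hn)
  set M : ℝ := (Fintype.card (BitMatrix n) : ℝ)
  have hM0 : 0 ≤ M := Nat.cast_nonneg _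
  have hone : ∀ T : Finset (Fin n), T.card = n / 3 →
      ((Finset.univ.filter fun U : BitMatrix n => ¬ Balanced U T d η).card : ℝ) ≤ M * (1 / 20) := by
    intro T hT
    refine (card_not_balanced_le T d hη.le hη1).trans ?_
    refine mul_le_mul_of_nonneg_left ?_ hM0
    have hn4 : (n : ℝ) / 4 ≤ T.card := by
      have : n ≤ 4 * T.card := by omega
      have : (n : ℝ) ≤ 4 * T.card := by exact_mod_cast this
      linarith
    have h1 : Real.exp (-(η ^ 2 / 4 * T.card)) ≤ Real.exp (-(η ^ 2 / 16 * n)) := by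
      refine Real.exp_le_exp.2 (neg_le_neg ?_)
      calc η ^ 2 / 16 * n = η ^ 2 / 4 * (n / 4) := by ring
        _ ≤ _ := by gcongr
    calc ((d : ℝ) + 1) * (n + 1) ^ d * (2 * Real.exp (-(η ^ 2 / 4 * T.card)))
        ≤ ((d : ℝ) + 1) * (n + 1) ^ d * (2 * Real.exp (-(η ^ 2 / 16 * n))) := by gcongr
      _ = 2 * (d + 1) * ((n + 1) ^ d * Real.exp (-(η ^ 2 / 16 * n))) := by ring
      _ ≤ 2 * (d + 1) * (1 / (40 * (d + 1))) := by gcongr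
      _ = 1 / 20 := by field_simp; norm_num
  have hsplit : M ≤ ((Finset.univ.filter fun U : BitMatrix n =>
        Balanced U P d η ∧ Balanced U R d η).card : ℝ) +
      ((Finset.univ.filter fun U : BitMatrix n => ¬ Balanced U P d η).card +
        (Finset.univ.filter fun U : BitMatrix n => ¬ Balanced U R d η).card) := by
    rw [← Nat.cast_add, ← Nat.cast_add]
    refine Nat.cast_le.2 ?_
    rw [← Finset.card_univ]
    refine le_trans (Finset.card_le_card fun U _ => ?_) ((Finset.card_union_le _ _).trans
      (Nat.add_le_add_left (Finset.card_union_le _ _) _))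
    simp only [Finset.mem_filter, Finset.mem_univ, true_and, Finset.mem_union]
    tauto
  have := hone P hP
  have := hone R hR
  linarith

/-- If the bits are balanced, then repairing them gives a network that is far from computing the
constant `0`-function under the uniform distribution on the block indicators. -/
theorem farFrom_repair {K N : ℕ} [NeZero N] (e : Fin K × ZMod N ↪ Fin n) (hK : 3 ≤ K)
    {P R : Finset (Fin n)} (hPR : Disjoint P R) (a₀ : Fin K) (r : Fin K → ZMod N)
    (hP : P.card = n / 3) (hR : R.card = n / 3) (hO : (P ∪ R)ᶜ.card ≤ 2 * (n / 3))
    (hn : 12 ≤ n) (hN : n ≤ 2 * K * N) {U : BitMatrix n}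
    (hUP : Balanced U P (2 * K) ((1 / 2) ^ (2 * K) / 8))
    (hUR : Balanced U R (2 * K) ((1 / 2) ^ (2 * K) / 8)) {ε δ : ℝ}
    (hε : ε < (1 / 2) ^ K / (2048 * K)) (hδ : δ < 1 / 2) :
    (bitNetwork K P R (repair e r P a₀ U)).FarFrom ε δ (blockDistribution (block e r))
      (zeroFunction n) := by
  set h := n / 3 with hh
  have hK0 : (0 : ℝ) < K := by
    have : 0 < K := by omega
    exact_mod_cast this
  have hn0 : (0 : ℝ) < n := by
    have : 0 < n := by omega
    exact_mod_cast this
  set p : ℝ := (1 / 2) ^ K with hp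
  have hp0 : 0 < p := by positivity
  have hh4 : (n : ℝ) / 4 ≤ h := by
    have : n ≤ 4 * h := by omega
    have : (n : ℝ) ≤ 4 * h := by exact_mod_cast this
    linarith
  have hNn : (n : ℝ) / (2 * K) ≤ N := by
    rw [div_le_iff₀ (by positivity)]
    calc (n : ℝ) ≤ (2 * K * N : ℕ) := Nat.cast_le.2 hN
      _ = N * (2 * K) := by push_cast; ring
  have hεK : K * (ε * n) ≤ n * p / 2048 := by
    calc K * (ε * n) ≤ K * (p / (2048 * K) * n) := by gcongr
      _ = n * p / 2048 := by field_simp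
  have hgap : n * p / 512 ≤ h * p / 32 / 2 - K * (ε * n) := by
    have : (n : ℝ) / 4 * p ≤ h * p := by gcongr
    have : 0 < n * p := by positivity
    linarith
  refine farFrom_of_blocks _ _ (card_block e r) (block_disjoint e r) (v := h * p / 32) ?_ hδ ?_ ?_
  · intro t
    have hmem : blockColumn e r t a₀ ∈ block e r t :=
      Finset.mem_image_of_mem _ (Finset.mem_univ _)
    have hB := card_block e r t
    refine value_indicator_ge hK hPR hO hB ?_ ?_
    · rw [zeroRows_repair]
      have hc : ((block e r t).erase (blockColumn e r t a₀)).card = K - 1 := by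
        rw [Finset.card_erase_of_mem hmem, hB]
      have h1 := (abs_le.1 (hUP ((block e r t).erase (blockColumn e r t a₀))
        (by omega))).1
      rw [hc, hP] at h1
      linarith
    · rw [zeroRows_repair_of_disjoint e r P hPR]
      have h1 := (abs_le.1 (hUR (block e r t) (by omega))).2
      rw [hB, hR] at h1
      linarith
  · have : 0 < n * p := by positivity
    linarith
  · rw [ZMod.card]
    calc 2 * (ε * n * n) ≤ 2 * (p / (2048 * K) * n * n) := by gcongr
      _ = n / (2 * K) * (n * p / 512) := by field_simp; norm_num
      _ ≤ N * (h * p / 32 / 2 - K * (ε * n)) := by gcongr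

theorem exists_row_sets (hn : 12 ≤ n) : ∃ P R : Finset (Fin n), Disjoint P R ∧
    P.card = n / 3 ∧ R.card = n / 3 ∧ n / 3 ≤ (P ∪ R)ᶜ.card ∧ (P ∪ R)ᶜ.card ≤ 2 * (n / 3) := by
  obtain ⟨P, -, hP⟩ := Finset.exists_subset_card_eq (s := (Finset.univ : Finset (Fin n)))
    (n := n / 3) (by simp; omega)
  obtain ⟨R, hRP, hR⟩ := Finset.exists_subset_card_eq (s := Pᶜ) (n := n / 3)
    (by rw [Finset.card_compl, hP, Fintype.card_fin]; omega)
  have hPR : Disjoint P R := by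
    rw [Finset.disjoint_left]
    exact fun i hi hi' => Finset.mem_compl.1 (hRP hi') hi
  have hc : (P ∪ R)ᶜ.card = n - (n / 3 + n / 3) := by
    rw [Finset.card_compl, Finset.card_union_of_disjoint hPR, hP, hR, Fintype.card_fin]
  exact ⟨P, R, hPR, hP, hR, by omega, by omega⟩

/-- The inequality of `query_bound_of_good` in terms of the number `n` of columns. -/
theorem query_lower_bound {K n N q : ℕ} (hK : 3 ≤ K) (hn0 : 0 < n) (hNn : n ≤ 2 * K * N)
    (h : 6 / 5 * (N : ℝ) ^ K ≤ (N : ℝ) ^ K * (1 + 2 * (q / N)) + N * (q : ℝ) ^ K) :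
    1 / (200 * K) * (n : ℝ) ^ (1 - 1 / (K : ℝ)) ≤ q := by
  by_contra hcon
  push Not at hcon
  have hK0 : (0 : ℝ) < K := by
    have : 0 < K := by omega
    exact_mod_cast this
  have hn1 : (1 : ℝ) ≤ n := by exact_mod_cast hn0
  have hNn' : (n : ℝ) ≤ 2 * K * N := by exact_mod_cast hNn
  have hN0 : (0 : ℝ) < N := by
    by_contra hN
    have : (N : ℝ) = 0 := le_antisymm (not_lt.1 hN) (Nat.cast_nonneg _)
    rw [this] at hNn'
    linarith
  set X : ℝ := (n : ℝ) ^ (1 - 1 / (K : ℝ)) with hX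
  have hX0 : 0 ≤ X := by positivity
  have hXn : X ≤ n := by
    calc X ≤ (n : ℝ) ^ (1 : ℝ) := Real.rpow_le_rpow_of_exponent_le hn1 (by
          have : 0 ≤ 1 / (K : ℝ) := by positivity
          linarith)
      _ = n := Real.rpow_one _
  have hXK : X ^ K = (n : ℝ) ^ (K - 1) := by
    rw [hX, ← Real.rpow_natCast, ← Real.rpow_mul (by positivity), ← Real.rpow_natCast]
    congr 1
    rw [Nat.cast_sub (by omega), sub_mul, one_div, inv_mul_cancel₀ hK0.ne']
    simp
  have h1 : (q : ℝ) / N ≤ 1 / 100 := by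
    rw [div_le_iff₀ hN0]
    calc (q : ℝ) ≤ 1 / (200 * K) * X := hcon.le
      _ ≤ 1 / (200 * K) * (2 * K * N) := by gcongr; exact hXn.trans hNn'
      _ = 1 / 100 * N := by field_simp; norm_num
  have h2 : (N : ℝ) * (q : ℝ) ^ K ≤ 1 / 100 * (N : ℝ) ^ K := by
    obtain ⟨k, rfl⟩ : ∃ k, K = k + 1 := ⟨K - 1, by omega⟩
    rw [Nat.add_sub_cancel] at hXK
    set c : ℝ := 1 / (200 * (k + 1 : ℕ)) with hc
    have hc0 : 0 ≤ c := by positivity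
    have hc1 : c ≤ 1 / 100 := by
      rw [hc, one_div_le_one_div (by positivity) (by norm_num)]
      have : (1 : ℝ) ≤ (k + 1 : ℕ) := by exact_mod_cast Nat.succ_le_succ (Nat.zero_le k)
      linarith
    have hcn : c * n ≤ N := by
      calc c * n ≤ c * (2 * (k + 1 : ℕ) * N) := by gcongr
        _ = 1 / 100 * N := by rw [hc]; field_simp; norm_num
        _ ≤ N := by linarith
    calc (N : ℝ) * (q : ℝ) ^ (k + 1) ≤ N * (c * X) ^ (k + 1) := by gcongr
      _ = N * c * (c * n) ^ k := by rw [mul_pow, hXK]; ring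
      _ ≤ N * (1 / 100) * (N : ℝ) ^ k := by gcongr
      _ = 1 / 100 * (N : ℝ) ^ (k + 1) := by ring
  have h3 : (N : ℝ) ^ K * (1 + 2 * (q / N)) ≤ (N : ℝ) ^ K * (1 + 2 * (1 / 100)) := by gcongr
  have h4 : (0 : ℝ) < (N : ℝ) ^ K := by positivity
  linarith

end ReLUTesting

open ReLUTesting in
theorem mainTheorem2 (k : ℝ) (hk : 1 < k) :
    ∃ ε₀ : ℝ, 0 < ε₀ ∧ ∃ c : ℝ, 0 < c ∧ ∃ n₀ : ℕ, ∀ n : ℕ, n₀ ≤ n →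
      ∀ ε δ : ℝ, 0 < ε → ε < ε₀ → 0 < δ → δ < 1 / 2 →
        ∀ (T : ReLUTesting.RandomizedAlgorithm.{u} n n) (q : ℕ),
          T.IsDistributionFreeTester ε δ (ReLUTesting.zeroFunction n) →
          T.QueriesAtMost q →
          c * (n : ℝ) ^ (1 - 1 / k) ≤ (q : ℝ) := by
  classical
  obtain ⟨K, hK3, hkK⟩ : ∃ K : ℕ, 3 ≤ K ∧ k ≤ K :=
    ⟨max 3 ⌈k⌉₊, le_max_left _ _, (Nat.le_ceil k).trans (by exact_mod_cast le_max_right _ _)⟩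
  have hK0 : (0 : ℝ) < K := by linarith
  have hη1 : ((1 : ℝ) / 2) ^ (2 * K) / 8 ≤ 1 := by
    have : ((1 : ℝ) / 2) ^ (2 * K) ≤ 1 := pow_le_one₀ (by norm_num) (by norm_num)
    linarith
  obtain ⟨n₁, hn₁⟩ := exists_card_balanced_ge (2 * K) (by positivity) hη1
  refine ⟨(1 / 2) ^ K / (2048 * K), by positivity, 1 / (200 * K), by positivity,
    max n₁ (max 12 K), fun n hn ε δ _ hε _ hδ T q hT hq => ?_⟩
  have hnn₁ : n₁ ≤ n := (le_max_left _ _).trans hn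
  have hn12 : 12 ≤ n := (le_max_left _ _).trans ((le_max_right _ _).trans hn)
  have hnK : K ≤ n := (le_max_right _ _).trans ((le_max_right _ _).trans hn)
  obtain ⟨P, R, hPR, hP, hR, hO, hO'⟩ := exists_row_sets hn12
  have hNpos : 0 < n / K := Nat.div_pos hnK (by omega)
  have : NeZero (n / K) := ⟨hNpos.ne'⟩
  have hN : n ≤ 2 * K * (n / K) := by
    have h1 := Nat.div_add_mod n K
    have h2 := Nat.mod_lt n (show 0 < K by omega)
    have h3 : K ≤ K * (n / K) := Nat.le_mul_of_pos_right K hNpos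
    rw [mul_assoc]
    omega
  obtain ⟨e⟩ : Nonempty (Fin K × ZMod (n / K) ↪ Fin n) :=
    Function.Embedding.nonempty_of_card_le (by simpa [ZMod.card] using Nat.mul_div_le n K)
  have hbound := query_bound_of_good e P R ⟨0, by omega⟩ _ (hn₁ n hnn₁ P R hP hR)
    (fun U hU => compute_bitNetwork (by omega) hPR hP hR hO
      (Finset.mem_filter.1 hU).2.1 (Finset.mem_filter.1 hU).2.2)
    (fun U hU r => farFrom_repair e hK3 hPR ⟨0, by omega⟩ r hP hR hO' hn12 hN
      (Finset.mem_filter.1 hU).2.1 (Finset.mem_filter.1 hU).2.2 hε hδ) T hT hq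
  refine le_trans ?_ (query_lower_bound hK3 (by omega) hN hbound)
  have hn1 : (1 : ℝ) ≤ n := by
    have : 1 ≤ n := by omega
    exact_mod_cast this
  -- The exponent only grows when `k` is replaced by the integer `K ≥ k`.
  gcongr
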